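/- **Setting.** Let $X=(X_1,\dots,X_n)$ be an algebraically free tuple of self-adjoint elements of a tracial $W^*$-probability space, let $M=W^*(X_1,\dots,X_n)$ with its faithful normal tracial state $\tau$, and let $M$ act on $L^2(M)$ by left multiplication, with $1\in M\subset L^2(M)$, $\langle x,y\rangle=\tau(y^*x)$, and $f^*:=Jf$ for $f\in L^2(M)$, where $J$ is the isometric extension of $x\mapsto x^*$. Write $M_0=\mathbb C\langle X_1,\dots,X_n\rangle$ and let $\partial_j:M_0\to L^2(M)\bar\otimes L^2(M^{op})$ be the free difference quotients, i.e. the derivations (for the bimodule structure $a(b\otimes c)d=ab\otimes cd$) with $\partial_j X_i=\delta_{ij}\,1\otimes1$. Assume the Lipschitz conjugate variable condition: each $\partial_j$ is closable as an unbounded operator on $L^2(M)$, with closure $\bar\partial_j$; the conjugate variables $\xi_i=\partial_i^*(1\otimes 1)\in L^2(M)$ exist; and $\xi_i\in\mathrm{Dom}(\bar\partial):=\bigcap_j\mathrm{Dom}(\bar\partial_j)$ with $\bar\partial_j\xi_i\in M\bar\otimes M^{op}$ for all $i,j$. Assume also the condition $CD(1,\infty)$: $(\bar\partial_j\xi_i)_{i,j}\ge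 (1\otimes 1)\otimes I_n$ in $M_n(M\bar\otimes M^{op})$. **Lemma.** Let $f\in\mathrm{Dom}(\bar\partial)$ be centered ($\tau(f)=\langle f,1\rangle=0$), self-adjoint ($f=f^*$), and saturate the free Poincaré inequality: $\|f\|_{L^2(M)}^2=\sum_{j}\|\bar\partial_j f\|^2_{L^2(M)\bar\otimes L^2(M^{op})}$. Put $X_j^\circ=X_j-\tau(X_j)1$ and $\sigma=\|f\|_{L^2(M)}$. Then there are real numbers $c_1,\dots,c_n$ such that: 1. $f=\sum_j c_jX_j^\circ$ and $\sum_j c_j^2=\sigma^2$. 2. For every $g\in M_0$, $$\langle f,g\rangle=\sum_j\langle\bar\partial_j f,\partial_j g\rangle=\sum_j c_j\langle 1\otimes 1,\partial_j g\rangle=\sum_j c_j\langle\xi_j,g\rangle,$$ and $f=\sum_j c_j\xi_j$. If moreover $f\neq0$, then, with $\widehat f=f/\sigma$ and $\delta_f=\sum_j\frac{c_j}{\sigma}\partial_j$ (with domain $M_0$): 3. $\delta_f$ is a closable derivation into $L^2(M)\bar\otimes L^2(M^{op})$, $1\otimes1\in\mathrm{Dom}(\delta_f^*)$, $\widehat f=\delta_f^*(1\otimes1)=\sum_j\frac{c_j}{\sigma}\xi_j$,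 and $\delta_f(\widehat f)=1\otimes1$. 4. $\widehat f\in M$, $\tau(\widehat f)=0$, $\tau(\widehat f^{\,2})=1$, the moments satisfy $\tau(\widehat f^{\,m+1})=\sum_{k=0}^{m-1}\tau(\widehat f^{\,k})\tau(\widehat f^{\,m-1-k})$ for all $m\ge1$, and $\widehat f$ has the standard semicircular distribution, i.e. $\widehat f$ is self-adjoint and $\tau(\widehat f^{\,m})=\frac1{2\pi}\int_{-2}^2x^m\sqrt{4-x^2}\,dx$ for all $m\ge0$. -/

import Mathlib

open scoped TensorProduct InnerProductSpace ComplexOrder LinearPMap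

noncomputable section

namespace FreeObata

/-! ### Formal free difference quotients -/

section Formal

variable {n : ℕ}

/-- The algebra homomorphism `p ↦ [[p ⊗ 1, ∂ⱼ p], [0, 1 ⊗ p]]` encoding the free difference
quotient `∂ⱼ` on noncommutative polynomials. -/
def formalDQHom (j : Fin n) :
    FreeAlgebra ℂ (Fin n) →ₐ[ℂ]
      Matrix (Fin 2) (Fin 2) (FreeAlgebra ℂ (Fin n) ⊗[ℂ] FreeAlgebra ℂ (Fin n)) :=
  FreeAlgebra.lift ℂ fun i =>
    !![FreeAlgebra.ι ℂ i ⊗ₜ[ℂ] 1, if i = j then 1 else 0; 0, 1 ⊗ₜ[ℂ] FreeAlgebra.ι ℂ i]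

/-- The formal free difference quotient `∂ⱼ : ℂ⟨t₁,…,tₙ⟩ → ℂ⟨t₁,…,tₙ⟩ ⊗ ℂ⟨t₁,…,tₙ⟩`. It is
determined by `formalDQ_ι` and the Leibniz rule `formalDQ_mul` below. -/
def formalDQ (j : Fin n) :
    FreeAlgebra ℂ (Fin n) →ₗ[ℂ] FreeAlgebra ℂ (Fin n) ⊗[ℂ] FreeAlgebra ℂ (Fin n) :=
  Matrix.entryLinearMap ℂ _ 0 1 ∘ₗ (formalDQHom j).toLinearMap

theorem formalDQHom_diag (j : Fin n) (p : FreeAlgebra ℂ (Fin n)) :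
    formalDQHom j p 0 0 = p ⊗ₜ[ℂ] 1 ∧ formalDQHom j p 1 0 = 0 ∧
      formalDQHom j p 1 1 = 1 ⊗ₜ[ℂ] p := by
  induction p using FreeAlgebra.induction with
  | grade0 r =>
    simp [Algebra.algebraMap_eq_smul_one, TensorProduct.smul_tmul, Algebra.TensorProduct.one_def]
  | grade1 i => simp [formalDQHom]
  | mul a b ha hb =>
    simp [Matrix.mul_apply, Fin.sum_univ_two, ha, hb, Algebra.TensorProduct.tmul_mul_tmul]
  | add a b ha hb => simp [ha, hb, TensorProduct.add_tmul, TensorProduct.tmul_add]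

theorem formalDQ_ι (j i : Fin n) :
    formalDQ j (FreeAlgebra.ι ℂ i) = if i = j then 1 ⊗ₜ[ℂ] 1 else 0 := by
  simp [formalDQ, formalDQHom, Algebra.TensorProduct.one_def]

theorem formalDQ_mul (j : Fin n) (p q : FreeAlgebra ℂ (Fin n)) :
    formalDQ j (p * q) = (p ⊗ₜ[ℂ] 1) * formalDQ j q + formalDQ j p * (1 ⊗ₜ[ℂ] q) := by
  simp [formalDQ, Matrix.mul_apply, Fin.sum_univ_two, formalDQHom_diag]

end Formal

/-! ### Von Neumann algebras and Hilbert tensor products -/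

section Operators

variable {H : Type*} [NormedAddCommGroup H] [InnerProductSpace ℂ H] [CompleteSpace H]

/-- The von Neumann algebra generated by a set of bounded operators: the bicommutant of the
set together with its adjoints. -/
def wStar (S : Set (H →L[ℂ] H)) : VonNeumannAlgebra H where
  toStarSubalgebra :=
    StarSubalgebra.centralizer ℂ (StarSubalgebra.centralizer ℂ S : Set (H →L[ℂ] H))
  centralizer_centralizer' := by
    change Set.centralizer (Set.centralizer
      ((StarSubalgebra.centralizer ℂ
        (StarSubalgebra.centralizer ℂ S : Set (H →L[ℂ] H)) : StarSubalgebra ℂ (H →L[ℂ] H)) :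
          Set (H →L[ℂ] H))) = _
    rw [StarSubalgebra.coe_centralizer_centralizer, Set.centralizer_centralizer_centralizer]
    exact (StarSubalgebra.coe_centralizer_centralizer ℂ S).symm

end Operators

section HilbertTensor

variable {H : Type*} [NormedAddCommGroup H] [InnerProductSpace ℂ H]

variable (H) in
/-- The Hilbert space tensor product `H ⊗̄ H`. With `H = L²(M)` this is also
`L²(M) ⊗̄ L²(Mᵒᵖ)`, since `L²(Mᵒᵖ)` and `L²(M)` coincide as Hilbert spaces. -/
abbrev HTensor : Type _ := UniformSpace.Completion (H ⊗[ℂ] H)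

/-- The simple tensor `u ⊗ v` in `H ⊗̄ H`. -/
def htmul (u v : H) : HTensor H := ((u ⊗ₜ[ℂ] v : H ⊗[ℂ] H) : HTensor H)

/-- The operator `a ⊗ 1` on `H ⊗̄ H`. -/
def leftLeg (a : H →L[ℂ] H) : HTensor H →L[ℂ] HTensor H := (a.rTensor H).completion

/-- The operator `1 ⊗ a` on `H ⊗̄ H`. -/
def rightLeg (a : H →L[ℂ] H) : HTensor H →L[ℂ] HTensor H := (a.lTensor H).completion

end HilbertTensor

/-! ### Free difference quotients as unbounded operators

Here `H = L²(M)` and the vector `Ω` is `1 ∈ M ⊆ L²(M)`. -/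

section DifferenceQuotients

variable {n : ℕ} {H : Type*} [NormedAddCommGroup H] [InnerProductSpace ℂ H]

/-- The vector `p(X)` of `M₀ = ℂ⟨X₁,…,Xₙ⟩ ⊆ L²(M)`. -/
def polyVec (X : Fin n → H →L[ℂ] H) (Ω : H) : FreeAlgebra ℂ (Fin n) →ₗ[ℂ] H where
  toFun p := FreeAlgebra.lift ℂ X p Ω
  map_add' p q := by simp
  map_smul' r p := by simp

/-- The vector `(∂ⱼ p)(X)` of `M₀ ⊗ M₀ ⊆ L²(M) ⊗̄ L²(Mᵒᵖ)`. -/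
def dqVec (X : Fin n → H →L[ℂ] H) (Ω : H) (j : Fin n) :
    FreeAlgebra ℂ (Fin n) →ₗ[ℂ] HTensor H :=
  (UniformSpace.Completion.toComplL (𝕜 := ℂ) (E := H ⊗[ℂ] H)).toLinearMap ∘ₗ
    TensorProduct.map (polyVec X Ω) (polyVec X Ω) ∘ₗ formalDQ j

/-- The free difference quotient `∂ⱼ` as an unbounded operator from `L²(M)` to
`L²(M) ⊗̄ L²(Mᵒᵖ)` with domain `M₀`: its graph consists of the pairs `(p(X), (∂ⱼ p)(X))`
(which is the graph of a map because `X` is algebraically free). -/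
def freeDQ (X : Fin n → H →L[ℂ] H) (Ω : H) (j : Fin n) : H →ₗ.[ℂ] HTensor H :=
  (LinearMap.range ((polyVec X Ω).prod (dqVec X Ω j))).toLinearPMap

theorem polyVec_mem_domain (X : Fin n → H →L[ℂ] H) (Ω : H) (j : Fin n)
    (p : FreeAlgebra ℂ (Fin n)) : polyVec X Ω p ∈ (freeDQ X Ω j).domain := by
  rw [freeDQ, Submodule.toLinearPMap_domain]
  exact ⟨(polyVec X Ω p, dqVec X Ω j p), ⟨p, rfl⟩, rfl⟩

/-- The derivation `∑ⱼ cⱼ ∂ⱼ` with domain `M₀` (for `n ≥ 1`) and real coefficients `cⱼ`. -/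
def combDQ (X : Fin n → H →L[ℂ] H) (Ω : H) (c : Fin n → ℝ) : H →ₗ.[ℂ] HTensor H :=
  ∑ j, (c j : ℂ) • freeDQ X Ω j

end DifferenceQuotients

/-! ### The tuple `X`, its von Neumann algebra in standard form -/

section Tuple

variable {n : ℕ} {H : Type*} [NormedAddCommGroup H] [InnerProductSpace ℂ H] [CompleteSpace H]

/-- `X` is an algebraically free self-adjoint tuple, `M = W*(X₁,…,Xₙ)` acts in standard form on
`H = L²(M,τ)` (by left multiplication), and `Ω` is the vector `1 ∈ M ⊆ L²(M,τ)`: a cyclic and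
separating unit vector whose vector state `τ(x) = ⟨xΩ, Ω⟩` is the (faithful normal) trace. -/
structure IsTracialTuple (X : Fin n → H →L[ℂ] H) (Ω : H) : Prop where
  selfAdjoint : ∀ i, IsSelfAdjoint (X i)
  algebraicallyFree : Function.Injective (FreeAlgebra.lift ℂ X)
  norm_one : ‖Ω‖ = 1
  cyclic : Dense {u : H | ∃ x ∈ wStar (Set.range X), u = x Ω}
  separating : ∀ x ∈ wStar (Set.range X), x Ω = 0 → x = 0
  tracial : ∀ x ∈ wStar (Set.range X), ∀ y ∈ wStar (Set.range X),
    ⟪Ω, (x * y) Ω⟫_ℂ = ⟪Ω, (y * x) Ω⟫_ℂ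

/-- The trace `τ(x)` of an operator. -/
def trace (Ω : H) (x : H →L[ℂ] H) : ℂ := ⟪Ω, x Ω⟫_ℂ

/-- The self-adjoint elements `f = f* = Jf` of `L²(M)`. The Tomita conjugation `J` is the
isometric extension of `xΩ ↦ x*Ω`, so its graph is the closure of the graph of that map;
`f = Jf` says that `(f, f)` lies in that closure. -/
def IsL2SelfAdjoint (X : Fin n → H →L[ℂ] H) (Ω f : H) : Prop :=
  (f, f) ∈ closure {w : H × H | ∃ x ∈ wStar (Set.range X), w = (x Ω, star x Ω)}

/-- `R` is the operator of right multiplication by `b` on `L²(M)`: `R(xΩ) = x b Ω` for `x ∈ M`. -/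
def IsRightMul (X : Fin n → H →L[ℂ] H) (Ω : H) (b R : H →L[ℂ] H) : Prop :=
  ∀ x ∈ wStar (Set.range X), R (x Ω) = x (b Ω)

/-- The von Neumann algebra `M ⊗̄ Mᵒᵖ` on `L²(M) ⊗̄ L²(Mᵒᵖ)`: it is generated by `a ⊗ 1`, where
`a ∈ M` acts by left multiplication, and by `1 ⊗ R`, where `R` is the action of some
`b ∈ Mᵒᵖ`, that is, right multiplication by `b`. An element `T` of it is viewed in
`L²(M) ⊗̄ L²(Mᵒᵖ)` as the vector `T(1 ⊗ 1)`. -/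
def tensorOp (X : Fin n → H →L[ℂ] H) (Ω : H) : VonNeumannAlgebra (HTensor H) :=
  wStar ({T | ∃ a ∈ wStar (Set.range X), T = leftLeg a} ∪
    {T | ∃ b ∈ wStar (Set.range X), ∃ R, IsRightMul X Ω b R ∧ T = rightLeg R})

/-- The Lipschitz conjugate variable condition, with conjugate variables `ξᵢ = ∂ᵢ*(1 ⊗ 1)` and
Jacobian `Jac i j = ∂̄ⱼ ξᵢ ∈ M ⊗̄ Mᵒᵖ`. -/
structure IsLipschitzConjugate (X : Fin n → H →L[ℂ] H) (Ω : H) (ξ : Fin n → H)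
    (Jac : Matrix (Fin n) (Fin n) (HTensor H →L[ℂ] HTensor H)) : Prop where
  closable : ∀ j, (freeDQ X Ω j).IsClosable
  conjugate : ∀ i, (htmul Ω Ω, ξ i) ∈ (freeDQ X Ω i)†.graph
  jacobian_mem : ∀ i j, Jac i j ∈ tensorOp X Ω
  jacobian : ∀ i j, (ξ i, Jac i j (htmul Ω Ω)) ∈ (freeDQ X Ω j).closure.graph

/-- The condition `CD(c,∞)`: `Jac ≥ c (1 ⊗ 1) ⊗ Iₙ` as operators on `(L²(M) ⊗̄ L²(Mᵒᵖ))ⁿ`. The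
inequality between complex numbers includes that the right-hand side is real. -/
def CurvatureDimension (c : ℝ)
    (Jac : Matrix (Fin n) (Fin n) (HTensor H →L[ℂ] HTensor H)) : Prop :=
  ∀ η : Fin n → HTensor H,
    ((c * ∑ i, ‖η i‖ ^ 2 : ℝ) : ℂ) ≤ ∑ i, ∑ j, ⟪η i, Jac i j (η j)⟫_ℂ

/-- `δ` is a derivation from `M₀` to the `M`-bimodule `L²(M) ⊗̄ L²(Mᵒᵖ)`, whose actions are
`a (u ⊗ v) b = au ⊗ vb`. -/
def IsBimoduleDerivation (X : Fin n → H →L[ℂ] H) (Ω : H) (δ : H →ₗ.[ℂ] HTensor H) : Prop :=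
  δ.domain = LinearMap.range (polyVec X Ω) ∧
    ∀ (p q : FreeAlgebra ℂ (Fin n)) (u v : HTensor H),
      (polyVec X Ω p, u) ∈ δ.graph → (polyVec X Ω q, v) ∈ δ.graph →
        ∃ R : H →L[ℂ] H, IsRightMul X Ω (FreeAlgebra.lift ℂ X q) R ∧
          (polyVec X Ω (p * q), leftLeg (FreeAlgebra.lift ℂ X p) v + rightLeg R u) ∈ δ.graph

/-- The centered generator `Xⱼ° = Xⱼ - τ(Xⱼ) 1`. -/
def centeredGen (X : Fin n → H →L[ℂ] H) (Ω : H) (j : Fin n) : H →L[ℂ] H :=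
  X j - trace Ω (X j) • 1

end Tuple

/-! ### The semicircle law -/

/-- The standard semicircle law, with density `√(4 - x²) / (2π)` on `[-2, 2]`
(the real square root vanishes outside that interval). -/
def semicircleLaw : MeasureTheory.Measure ℝ :=
  MeasureTheory.volume.withDensity fun x => ENNReal.ofReal (√(4 - x ^ 2) / (2 * Real.pi))

/-- The self-adjoint operator `Y` has the standard semicircular distribution under the trace:
its moments are those of the semicircle law. -/
def IsStandardSemicircular {H : Type*} [NormedAddCommGroup H] [InnerProductSpace ℂ H]
    [CompleteSpace H] (Ω : H) (Y : H →L[ℂ] H) : Prop :=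
  IsSelfAdjoint Y ∧ ∀ m : ℕ, trace Ω (Y ^ m) = ((∫ x : ℝ, x ^ m ∂semicircleLaw : ℝ) : ℂ)

end FreeObata

end

open scoped TensorProduct InnerProductSpace ComplexOrder LinearPMap

noncomputable section

namespace FreeObata

/-! ### Simple tensors, legs and contractions -/

section Tensor

variable {H : Type*} [NormedAddCommGroup H] [InnerProductSpace ℂ H]

/-! Write A_j (`creation`) for a ↦ ∂_j*(a ⊗ 1) and T_j = A_j* = (1 ⊗ τ)∂_j (`annihilation`). The
Lipschitz condition makes these bounded: `inner_adjointDQ_adjointDQ` expresses ⟨A_i a, A_j b⟩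
through an entry of the Jacobian, and CD(1,∞) then says that the row A = (A_1,…,A_n) satisfies ‖Aη‖
≥ ‖η‖. Once A has dense range in the centered vectors, this dualizes to ‖f‖² ≤ ∑‖T_j f‖² ≤ ∑‖∂̄_j
f‖² for centered f.

Dense range means that only multiples of Ω are killed by every T_j; this is the main difficulty. Let
P be the projection onto the space K of centered vectors killed by all T_j. Since [T_j, X_k] =
δ_jk⟨Ω,·⟩Ω, each X_i maps K into K + ℂΩ, so [P, X_i] has rank at most two and is a tensor built from
W_i = P X_i Ω. The derivation formula [P, p] = ∑_j ∂_j p # [P, X_j], extended from polynomials to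
ξ_i, evaluates the Jacobian on these tensors, and the quadratic form in CD(1,∞) collapses to terms
in ⟨ξ_i, W_i⟩ = ⟨Ω, T_i W_i⟩ = 0. Hence W_i = 0 (`kernelVec_eq_zero`), P commutes with every X_i,
and PΩ = 0 forces P = 0 by density of M₀ (`eq_zero_of_mem_centeredKernel`).

If f saturates, both inequalities are equalities. Equality in the second gives ∂̄_j f = T_j f ⊗ 1,
and f = Jf then forces ∂̄_j f = c_j 1 ⊗ 1 with c_j real, so f - ∑ c_j X_j° lies in K = 0. Equality
in the first gives f = AA*f = ∑ c_j A_jΩ = ∑ c_j ξ_j (`exists_coefficients_of_saturated`).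

Finally, Y = f/‖f‖ satisfies both δY = 1 ⊗ 1 and Y = δ*(1 ⊗ 1), so τ(Y^(m+1)) = ⟨δ(Y^m), 1 ⊗ 1⟩
expands by Leibniz into the semicircular recursion (`trace_pow_succ`). The recursion and the
semicircle integrals both produce Catalan numbers. -/

theorem inner_htmul (a b c d : H) :
    ⟪htmul a b, htmul c d⟫_ℂ = ⟪a, c⟫_ℂ * ⟪b, d⟫_ℂ := by
  simp [htmul, UniformSpace.Completion.inner_coe]

theorem norm_htmul (a b : H) : ‖htmul a b‖ = ‖a‖ * ‖b‖ := by
  simp [htmul, UniformSpace.Completion.norm_coe]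

variable (H) in
/-- The bilinear map `(x, y) ↦ x ⊗ y`. -/
def htmulL : H →L[ℂ] H →L[ℂ] HTensor H :=
  (ContinuousLinearMap.compL ℂ H (H ⊗[ℂ] H) (HTensor H)
    (UniformSpace.Completion.toComplL (𝕜 := ℂ) (E := H ⊗[ℂ] H))) ∘L (TensorProduct.mkL ℂ H H)

theorem htmulL_apply (x y : H) : htmulL H x y = htmul x y := rfl

theorem continuous_htmul : Continuous fun w : H × H => htmul w.1 w.2 := by
  simp_rw [← htmulL_apply]; fun_prop

theorem smul_htmul (c : ℂ) (x y : H) : htmul (c • x) y = c • htmul x y := by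
  simp [← htmulL_apply]

theorem htensor_induction {P : HTensor H → Prop} (hc : IsClosed {z | P z})
    (h0 : P 0) (ht : ∀ u v, P (htmul u v)) (ha : ∀ y z, P y → P z → P (y + z)) (z : HTensor H) :
    P z := by
  induction z using UniformSpace.Completion.induction_on with
  | hp => exact hc
  | ih a =>
    induction a using TensorProduct.induction_on with
    | zero => rw [UniformSpace.Completion.coe_zero]; exact h0
    | tmul u v => exact ht u v
    | add x y hx hy =>
      rw [UniformSpace.Completion.coe_add]
      exact ha _ _ hx hy

theorem eq_zero_of_inner_htmul {D : Set H} (hD : Dense D) {E : Set H} (hE : Dense E)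
    {z : HTensor H} (h : ∀ x ∈ D, ∀ y ∈ E, ⟪htmul x y, z⟫_ℂ = 0) : z = 0 := by
  have h2 : ∀ w : H × H, ⟪htmul w.1 w.2, z⟫_ℂ = 0 := by
    have hcl : IsClosed {w : H × H | ⟪htmul w.1 w.2, z⟫_ℂ = 0} :=
      isClosed_eq (continuous_htmul.inner continuous_const) continuous_const
    have hsub : D ×ˢ E ⊆ {w : H × H | ⟪htmul w.1 w.2, z⟫_ℂ = 0} :=
      fun w hw => h _ hw.1 _ hw.2
    intro w
    exact hcl.closure_subset_iff.2 hsub ((hD.prod hE) w)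
  have h3 : ∀ w : HTensor H, ⟪w, z⟫_ℂ = 0 := by
    apply htensor_induction
    · exact isClosed_eq (continuous_id.inner continuous_const) continuous_const
    · simp
    · exact fun u v => h2 (u, v)
    · intro y w hy hw
      rw [inner_add_left, hy, hw, add_zero]
  exact inner_self_eq_zero.1 (h3 z)

theorem ext_inner_htmul {z w : HTensor H}
    (h : ∀ x y, ⟪htmul x y, z⟫_ℂ = ⟪htmul x y, w⟫_ℂ) : z = w := by
  rw [← sub_eq_zero]
  apply eq_zero_of_inner_htmul dense_univ dense_univ
  intro x _ y _
  rw [inner_sub_right, h, sub_self]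

theorem leftLeg_htmul (a : H →L[ℂ] H) (u v : H) : leftLeg a (htmul u v) = htmul (a u) v := by
  simp [leftLeg, htmul]

theorem rightLeg_htmul (a : H →L[ℂ] H) (u v : H) : rightLeg a (htmul u v) = htmul u (a v) := by
  simp [rightLeg, htmul]

variable [CompleteSpace H]

theorem inner_htmul_leftLeg (a : H →L[ℂ] H) (x y : H) (z : HTensor H) :
    ⟪htmul x y, leftLeg a z⟫_ℂ = ⟪htmul (star a x) y, z⟫_ℂ := by
  induction z using htensor_induction with
  | hc => exact isClosed_eq (by fun_prop) (by fun_prop)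
  | h0 => simp
  | ht u v =>
    rw [leftLeg_htmul, inner_htmul, inner_htmul, ContinuousLinearMap.star_eq_adjoint,
      ContinuousLinearMap.adjoint_inner_left]
  | ha y z hy hz => rw [map_add, inner_add_right, inner_add_right, hy, hz]

theorem inner_htmul_rightLeg (a : H →L[ℂ] H) (x y : H) (z : HTensor H) :
    ⟪htmul x y, rightLeg a z⟫_ℂ = ⟪htmul x (star a y), z⟫_ℂ := by
  induction z using htensor_induction with
  | hc => exact isClosed_eq (by fun_prop) (by fun_prop)
  | h0 => simp
  | ht u v =>
    rw [rightLeg_htmul, inner_htmul, inner_htmul, ContinuousLinearMap.star_eq_adjoint,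
      ContinuousLinearMap.adjoint_inner_left]
  | ha y z hy hz => rw [map_add, inner_add_right, inner_add_right, hy, hz]

theorem star_leftLeg (a : H →L[ℂ] H) : star (leftLeg a) = leftLeg (star a) := by
  ext z
  apply ext_inner_htmul
  intro x y
  rw [inner_htmul_leftLeg, star_star, ContinuousLinearMap.star_eq_adjoint,
    ContinuousLinearMap.adjoint_inner_right, leftLeg_htmul]

theorem star_rightLeg (a : H →L[ℂ] H) : star (rightLeg a) = rightLeg (star a) := by
  ext z
  apply ext_inner_htmul
  intro x y
  rw [inner_htmul_rightLeg, star_star, ContinuousLinearMap.star_eq_adjoint,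
    ContinuousLinearMap.adjoint_inner_right, rightLeg_htmul]

theorem leftLeg_mul (a b : H →L[ℂ] H) : leftLeg (a * b) = leftLeg a * leftLeg b := by
  ext z
  apply ext_inner_htmul
  intro x y
  simp [inner_htmul_leftLeg]

theorem rightLeg_mul (a b : H →L[ℂ] H) : rightLeg (a * b) = rightLeg a * rightLeg b := by
  ext z
  apply ext_inner_htmul
  intro x y
  simp [inner_htmul_rightLeg]

theorem commute_leftLeg_rightLeg (a b : H →L[ℂ] H) : Commute (leftLeg a) (rightLeg b) := by
  ext z
  apply ext_inner_htmul
  intro x y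
  simp [inner_htmul_rightLeg, inner_htmul_leftLeg]

theorem Commute.leftLeg {a b : H →L[ℂ] H} (h : Commute a b) :
    Commute (leftLeg a) (leftLeg b) := by
  rw [Commute, SemiconjBy, ← leftLeg_mul, ← leftLeg_mul, h.eq]

theorem Commute.rightLeg {a b : H →L[ℂ] H} (h : Commute a b) :
    Commute (rightLeg a) (rightLeg b) := by
  rw [Commute, SemiconjBy, ← rightLeg_mul, ← rightLeg_mul, h.eq]

/-- The contraction `u ⊗ v ↦ ⟪y, v⟫ u` of the right leg. -/
def contrR (y : H) : HTensor H →L[ℂ] H := ((htmulL H).flip y).adjoint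

/-- The contraction `u ⊗ v ↦ ⟪x, u⟫ v` of the left leg. -/
def contrL (x : H) : HTensor H →L[ℂ] H := (htmulL H x).adjoint

theorem inner_contrR (x y : H) (z : HTensor H) :
    ⟪x, contrR y z⟫_ℂ = ⟪htmul x y, z⟫_ℂ := by
  rw [contrR, ContinuousLinearMap.adjoint_inner_right]; rfl

theorem inner_contrL (x y : H) (z : HTensor H) :
    ⟪y, contrL x z⟫_ℂ = ⟪htmul x y, z⟫_ℂ := by
  rw [contrL, ContinuousLinearMap.adjoint_inner_right]; rfl

theorem contrR_htmul (y u v : H) : contrR y (htmul u v) = ⟪y, v⟫_ℂ • u := by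
  refine ext_inner_left ℂ fun x => ?_
  rw [inner_contrR, inner_htmul, inner_smul_right, mul_comm]

theorem contrL_htmul (x u v : H) : contrL x (htmul u v) = ⟪x, u⟫_ℂ • v := by
  refine ext_inner_left ℂ fun y => ?_
  rw [inner_contrL, inner_htmul, inner_smul_right]

theorem norm_contrR_le (y : H) (z : HTensor H) : ‖contrR y z‖ ≤ ‖y‖ * ‖z‖ := by
  have h := inner_contrR (contrR y z) y z
  have h1 : ‖contrR y z‖ ^ 2 ≤ ‖contrR y z‖ * (‖y‖ * ‖z‖) := by
    calc ‖contrR y z‖ ^ 2 = ‖⟪contrR y z, contrR y z⟫_ℂ‖ := by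
          rw [inner_self_eq_norm_sq_to_K]; simp
      _ = ‖⟪htmul (contrR y z) y, z⟫_ℂ‖ := by rw [h]
      _ ≤ ‖htmul (contrR y z) y‖ * ‖z‖ := norm_inner_le_norm _ _
      _ = _ := by rw [norm_htmul, mul_assoc]
  by_cases h0 : ‖contrR y z‖ = 0
  · rw [h0]; positivity
  · have : 0 < ‖contrR y z‖ := lt_of_le_of_ne (norm_nonneg _) (Ne.symm h0)
    nlinarith

/-- If contracting with a unit vector preserves the norm, the tensor is simple. -/
theorem eq_htmul_of_norm_le_contrR {y : H} (hy : ‖y‖ = 1) {z : HTensor H}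
    (h : ‖z‖ ≤ ‖contrR y z‖) : z = htmul (contrR y z) y := by
  have h1 : ‖z - htmul (contrR y z) y‖ ^ 2 = ‖z‖ ^ 2 - ‖contrR y z‖ ^ 2 := by
    rw [@norm_sub_sq ℂ, norm_htmul, hy, mul_one]
    have : RCLike.re ⟪z, htmul (contrR y z) y⟫_ℂ = ‖contrR y z‖ ^ 2 := by
      rw [← inner_conj_symm, ← inner_contrR, inner_self_eq_norm_sq_to_K]
      norm_cast
    rw [this]; ring
  have h2 : ‖z - htmul (contrR y z) y‖ ^ 2 ≤ 0 := by
    rw [h1]; nlinarith [norm_nonneg z]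
  have h3 : ‖z - htmul (contrR y z) y‖ = 0 := by
    have := sq_nonneg ‖z - htmul (contrR y z) y‖
    exact pow_eq_zero_iff (two_ne_zero) |>.1 (le_antisymm h2 this)
  exact sub_eq_zero.1 (norm_eq_zero.1 h3)

end Tensor

/-! ### The conjugate-linear involution on noncommutative polynomials -/

section StarPoly

variable {n : ℕ}

/-- Induction on noncommutative polynomials by left multiplication with a generator. -/
theorem freeAlgebra_induction_left {P : FreeAlgebra ℂ (Fin n) → Prop} (h1 : P 1)
    (hadd : ∀ p q, P p → P q → P (p + q)) (hsmul : ∀ (c : ℂ) p, P p → P (c • p))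
    (hmul : ∀ k p, P p → P (FreeAlgebra.ι ℂ k * p)) (p : FreeAlgebra ℂ (Fin n)) : P p := by
  have key : ∀ q : FreeAlgebra ℂ (Fin n), ∀ p, P p → P (q * p) := by
    intro q
    induction q using FreeAlgebra.induction with
    | grade0 r =>
      intro p hp
      rw [← Algebra.smul_def]
      exact hsmul r p hp
    | grade1 k => exact hmul k
    | mul a b ha hb =>
      intro p hp
      rw [mul_assoc]
      exact ha _ (hb _ hp)
    | add a b ha hb =>
      intro p hp
      rw [add_mul]
      exact hadd _ _ (ha _ hp) (hb _ hp)
  simpa using key p 1 h1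

/-- The involution of `ℂ⟨t₁,…,tₙ⟩` as a ring homomorphism to the opposite ring: it fixes the
generators and conjugates the coefficients. -/
def starPolyHom : FreeAlgebra ℂ (Fin n) →+* (FreeAlgebra ℂ (Fin n))ᵐᵒᵖ :=
  letI : Algebra ℂ (FreeAlgebra ℂ (Fin n))ᵐᵒᵖ :=
    Algebra.compHom (FreeAlgebra ℂ (Fin n))ᵐᵒᵖ (starRingEnd ℂ)
  (FreeAlgebra.lift ℂ (A := (FreeAlgebra ℂ (Fin n))ᵐᵒᵖ)
    fun i => MulOpposite.op (FreeAlgebra.ι ℂ i)).toRingHom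

/-- The conjugate-linear, multiplication reversing involution of `ℂ⟨t₁,…,tₙ⟩`. -/
def starPoly (p : FreeAlgebra ℂ (Fin n)) : FreeAlgebra ℂ (Fin n) :=
  MulOpposite.unop (starPolyHom p)

theorem starPoly_ι (i : Fin n) : starPoly (FreeAlgebra.ι ℂ i) = FreeAlgebra.ι ℂ i := by
  let : Algebra ℂ (FreeAlgebra ℂ (Fin n))ᵐᵒᵖ :=
    Algebra.compHom (FreeAlgebra ℂ (Fin n))ᵐᵒᵖ (starRingEnd ℂ)
  exact congrArg MulOpposite.unop (FreeAlgebra.lift_ι_apply _ i)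

theorem starPoly_algebraMap (r : ℂ) :
    starPoly (algebraMap ℂ (FreeAlgebra ℂ (Fin n)) r) =
      algebraMap ℂ (FreeAlgebra ℂ (Fin n)) (starRingEnd ℂ r) := by
  let : Algebra ℂ (FreeAlgebra ℂ (Fin n))ᵐᵒᵖ :=
    Algebra.compHom (FreeAlgebra ℂ (Fin n))ᵐᵒᵖ (starRingEnd ℂ)
  exact congrArg MulOpposite.unop
    ((FreeAlgebra.lift ℂ (A := (FreeAlgebra ℂ (Fin n))ᵐᵒᵖ)
      fun i => MulOpposite.op (FreeAlgebra.ι ℂ i)).commutes r)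

theorem starPoly_mul (p q : FreeAlgebra ℂ (Fin n)) :
    starPoly (p * q) = starPoly q * starPoly p := by
  simp [starPoly]

theorem starPoly_add (p q : FreeAlgebra ℂ (Fin n)) :
    starPoly (p + q) = starPoly p + starPoly q := by
  simp [starPoly]

theorem starPoly_smul (c : ℂ) (p : FreeAlgebra ℂ (Fin n)) :
    starPoly (c • p) = starRingEnd ℂ c • starPoly p := by
  rw [Algebra.smul_def, starPoly_mul, starPoly_algebraMap, ← Algebra.commutes, Algebra.smul_def]

theorem starPoly_one : starPoly (1 : FreeAlgebra ℂ (Fin n)) = 1 := by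
  simp [starPoly]

theorem starPoly_starPoly (p : FreeAlgebra ℂ (Fin n)) : starPoly (starPoly p) = p := by
  induction p using FreeAlgebra.induction with
  | grade0 r => simp [starPoly_algebraMap]
  | grade1 k => simp [starPoly_ι]
  | mul a b ha hb => rw [starPoly_mul, starPoly_mul, ha, hb]
  | add a b ha hb => rw [starPoly_add, starPoly_add, ha, hb]

end StarPoly

/-! ### Evaluation of noncommutative polynomials at the trace vector -/

section PolyVec

variable {H : Type*} [NormedAddCommGroup H] [InnerProductSpace ℂ H]
variable {n : ℕ} {X : Fin n → H →L[ℂ] H} {Ω : H}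

theorem polyVec_apply (p : FreeAlgebra ℂ (Fin n)) :
    polyVec X Ω p = FreeAlgebra.lift ℂ X p Ω := rfl

theorem polyVec_one : polyVec X Ω 1 = Ω := by simp [polyVec_apply]

theorem polyVec_mul (p q : FreeAlgebra ℂ (Fin n)) :
    polyVec X Ω (p * q) = FreeAlgebra.lift ℂ X p (polyVec X Ω q) := by
  simp [polyVec_apply]

theorem polyVec_ι_mul (k : Fin n) (q : FreeAlgebra ℂ (Fin n)) :
    polyVec X Ω (FreeAlgebra.ι ℂ k * q) = X k (polyVec X Ω q) := by
  simp [polyVec_mul]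

end PolyVec

/-! ### The generated von Neumann algebra -/

section WStar

variable {H : Type*} [NormedAddCommGroup H] [InnerProductSpace ℂ H] [CompleteSpace H]

/-- The adjoint half of the bicommutant condition is automatic, because the commutant of a set
together with its adjoints is closed under star. -/
theorem mem_wStar_iff {S : Set (H →L[ℂ] H)} {x : H →L[ℂ] H} :
    x ∈ wStar S ↔ ∀ y, (∀ s ∈ S, Commute s y ∧ Commute (star s) y) → Commute y x := by
  change x ∈ StarSubalgebra.centralizer ℂ
    (StarSubalgebra.centralizer ℂ S : Set (H →L[ℂ] H)) ↔ _
  rw [StarSubalgebra.mem_centralizer_iff]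
  constructor
  · intro h y hy
    exact (h y ((StarSubalgebra.mem_centralizer_iff ℂ).2 hy)).1
  · intro h y hy
    refine ⟨h y ((StarSubalgebra.mem_centralizer_iff ℂ).1 hy), ?_⟩
    exact h (star y) ((StarSubalgebra.mem_centralizer_iff ℂ).1 (star_mem hy))

theorem subset_wStar (S : Set (H →L[ℂ] H)) {s : H →L[ℂ] H} (hs : s ∈ S) : s ∈ wStar S :=
  mem_wStar_iff.2 fun _ hy => (hy s hs).1.symm

variable {n : ℕ} {X : Fin n → H →L[ℂ] H} {Ω : H}

theorem lift_mem_wStar (X : Fin n → H →L[ℂ] H) (p : FreeAlgebra ℂ (Fin n)) :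
    FreeAlgebra.lift ℂ X p ∈ wStar (Set.range X) := by
  induction p using FreeAlgebra.induction with
  | grade0 r =>
    rw [AlgHom.commutes]
    exact (wStar (Set.range X)).toStarSubalgebra.algebraMap_mem r
  | grade1 k =>
    rw [FreeAlgebra.lift_ι_apply]
    exact subset_wStar _ ⟨k, rfl⟩
  | mul a b ha hb => rw [map_mul]; exact mul_mem ha hb
  | add a b ha hb => rw [map_add]; exact add_mem ha hb

theorem lift_starPoly (hX : ∀ i, IsSelfAdjoint (X i)) (p : FreeAlgebra ℂ (Fin n)) :
    FreeAlgebra.lift ℂ X (starPoly p) = star (FreeAlgebra.lift ℂ X p) := by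
  induction p using FreeAlgebra.induction with
  | grade0 r =>
    rw [starPoly_algebraMap, AlgHom.commutes, AlgHom.commutes, ← algebraMap_star_comm]
    rfl
  | grade1 k => rw [starPoly_ι, FreeAlgebra.lift_ι_apply, (hX k).star_eq]
  | mul a b ha hb => rw [starPoly_mul, map_mul, ha, hb, map_mul, star_mul]
  | add a b ha hb => rw [starPoly_add, map_add, ha, hb, map_add, star_add]

namespace IsTracialTuple

variable (hX : IsTracialTuple X Ω)
include hX

theorem inner_self : ⟪Ω, Ω⟫_ℂ = 1 := by
  rw [inner_self_eq_norm_sq_to_K, hX.norm_one]; simp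

theorem polyVec_injective : Function.Injective (polyVec X Ω) := by
  rw [injective_iff_map_eq_zero]
  intro p hp
  have := hX.separating _ (lift_mem_wStar X p) hp
  exact (injective_iff_map_eq_zero _).1 hX.algebraicallyFree p this

/-- `M₀` is dense in `L²(M)`. -/
theorem denseRange_polyVec : DenseRange (polyVec X Ω) := by
  set V : Submodule ℂ H := (LinearMap.range (polyVec X Ω)).topologicalClosure with hV
  have : CompleteSpace V := (Submodule.isClosed_topologicalClosure _).completeSpace_coe
  have hmem : ∀ p, polyVec X Ω p ∈ V := fun p =>
    Submodule.le_topologicalClosure _ ⟨p, rfl⟩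
  have hinv : ∀ k, ∀ v ∈ V, X k v ∈ V := by
    intro k v hv
    have hcl : IsClosed {v | X k v ∈ V} :=
      (Submodule.isClosed_topologicalClosure _).preimage (X k).continuous
    refine hcl.closure_subset_iff.2 ?_ (show v ∈ closure _ from hv)
    rintro _ ⟨p, rfl⟩
    change X k _ ∈ V
    rw [← polyVec_ι_mul]
    exact hmem _
  -- `V` is invariant under self-adjoint generators, so its projection commutes with them and hence
  -- with all of M. As it fixes Ω, `V` contains MΩ, which is dense.
  have hcomm : ∀ k, Commute (X k) V.starProjection := by
    intro k
    ext v
    change X k (V.starProjection v) = V.starProjection (X k v)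
    symm
    apply Submodule.eq_starProjection_of_mem_orthogonal
    · exact hinv k _ (Submodule.starProjection_apply_mem _ _)
    · rw [← map_sub, Submodule.mem_orthogonal]
      intro u hu
      have h1 : ⟪u, X k (v - V.starProjection v)⟫_ℂ = ⟪X k u, v - V.starProjection v⟫_ℂ :=
        ((hX.selfAdjoint k).isSymmetric u _).symm
      rw [h1]
      exact (Submodule.mem_orthogonal _ _).1 (V.sub_starProjection_mem_orthogonal v) _
        (hinv k u hu)
  have hΩ : V.starProjection Ω = Ω :=
    Submodule.starProjection_eq_self_iff.2 (by simpa [polyVec_one] using hmem 1)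
  have hsub : {u : H | ∃ x ∈ wStar (Set.range X), u = x Ω} ⊆ V := by
    rintro _ ⟨x, hx, rfl⟩
    have hc := mem_wStar_iff.1 hx V.starProjection (by
      rintro _ ⟨k, rfl⟩
      rw [(hX.selfAdjoint k).star_eq]
      exact ⟨hcomm k, hcomm k⟩)
    have h2 : V.starProjection (x Ω) = x (V.starProjection Ω) :=
      DFunLike.congr_fun hc.eq Ω
    rw [hΩ] at h2
    rw [SetLike.mem_coe, ← h2]
    exact Submodule.starProjection_apply_mem _ _
  intro v
  have := closure_mono hsub (hX.cyclic v)
  rwa [IsClosed.closure_eq (Submodule.isClosed_topologicalClosure _)] at this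

/-- Traciality, τ(pp*) = τ(p*p), is the isometry that lets the involution extend to J on all of
L²(M). -/
theorem norm_polyVec_starPoly (p : FreeAlgebra ℂ (Fin n)) :
    ‖polyVec X Ω (starPoly p)‖ = ‖polyVec X Ω p‖ := by
  have h := hX.tracial _ (lift_mem_wStar X p) _ (lift_mem_wStar X (starPoly p))
  rw [lift_starPoly hX.selfAdjoint] at h
  simp only [mul_apply_eq_comp, ContinuousLinearMap.star_eq_adjoint,
    ContinuousLinearMap.adjoint_inner_right] at h
  rw [← ContinuousLinearMap.adjoint_inner_left, inner_self_eq_norm_sq_to_K,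
    inner_self_eq_norm_sq_to_K] at h
  have h2 : ‖polyVec X Ω (starPoly p)‖ ^ 2 = ‖polyVec X Ω p‖ ^ 2 := by
    rw [polyVec_apply, lift_starPoly hX.selfAdjoint, ContinuousLinearMap.star_eq_adjoint,
      polyVec_apply]
    exact_mod_cast h
  exact (sq_eq_sq₀ (norm_nonneg _) (norm_nonneg _)).1 h2

end IsTracialTuple

/-! ### The Tomita conjugation, right multiplication and the commutant of M ⊗̄ Mᵒᵖ -/

/-- The conjugate-linear map `p ↦ p(X)* Ω`. -/
def starPolyVec (X : Fin n → H →L[ℂ] H) (Ω : H) : FreeAlgebra ℂ (Fin n) →ₛₗ[starRingEnd ℂ] H where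
  toFun p := polyVec X Ω (starPoly p)
  map_add' p q := by rw [starPoly_add, map_add]
  map_smul' c p := by rw [starPoly_smul, map_smul]

/-- The Tomita conjugation `J`. -/
def tomitaJ (X : Fin n → H →L[ℂ] H) (Ω : H) : H →SL[starRingEnd ℂ] H :=
  (starPolyVec X Ω).extendOfNorm (polyVec X Ω)

/-- Right multiplication `J a* J` by `a`. -/
def rmul (X : Fin n → H →L[ℂ] H) (Ω : H) (a : H →L[ℂ] H) : H →L[ℂ] H :=
  (tomitaJ X Ω).comp ((star a).comp (tomitaJ X Ω))

theorem rmul_apply (a : H →L[ℂ] H) (v : H) :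
    rmul X Ω a v = tomitaJ X Ω (star a (tomitaJ X Ω v)) := rfl

namespace IsTracialTuple

variable (hX : IsTracialTuple X Ω)
include hX

theorem tomitaJ_polyVec (p : FreeAlgebra ℂ (Fin n)) :
    tomitaJ X Ω (polyVec X Ω p) = polyVec X Ω (starPoly p) :=
  LinearMap.extendOfNorm_eq hX.denseRange_polyVec
    ⟨1, fun p => by rw [one_mul]; exact (hX.norm_polyVec_starPoly p).le⟩ p

theorem tomitaJ_Ω : tomitaJ X Ω Ω = Ω := by
  simpa [polyVec_one, starPoly_one] using hX.tomitaJ_polyVec 1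

theorem tomitaJ_tomitaJ (v : H) : tomitaJ X Ω (tomitaJ X Ω v) = v := by
  induction v using hX.denseRange_polyVec.induction_on with
  | hp => exact isClosed_eq (by fun_prop) continuous_id
  | ih p => rw [hX.tomitaJ_polyVec, hX.tomitaJ_polyVec, starPoly_starPoly]

theorem inner_tomitaJ (u v : H) : ⟪u, tomitaJ X Ω v⟫_ℂ = ⟪v, tomitaJ X Ω u⟫_ℂ := by
  induction u, v using hX.denseRange_polyVec.induction_on₂ with
  | hp => exact isClosed_eq (by fun_prop) (by fun_prop)
  | h p q =>
    rw [hX.tomitaJ_polyVec, hX.tomitaJ_polyVec, polyVec_apply, polyVec_apply, polyVec_apply,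
      polyVec_apply, lift_starPoly hX.selfAdjoint, lift_starPoly hX.selfAdjoint]
    have h := hX.tracial _ (lift_mem_wStar X (starPoly p)) _ (lift_mem_wStar X (starPoly q))
    rw [lift_starPoly hX.selfAdjoint, lift_starPoly hX.selfAdjoint] at h
    simpa only [mul_apply_eq_comp, ContinuousLinearMap.star_eq_adjoint,
      ContinuousLinearMap.adjoint_inner_right] using h

theorem inner_tomitaJ_left (u v : H) : ⟪tomitaJ X Ω u, v⟫_ℂ = ⟪tomitaJ X Ω v, u⟫_ℂ := by
  rw [← inner_conj_symm, hX.inner_tomitaJ, inner_conj_symm]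

theorem norm_tomitaJ (v : H) : ‖tomitaJ X Ω v‖ = ‖v‖ := by
  have h := hX.inner_tomitaJ (tomitaJ X Ω v) v
  rw [hX.tomitaJ_tomitaJ, inner_self_eq_norm_sq_to_K, inner_self_eq_norm_sq_to_K] at h
  exact (sq_eq_sq₀ (norm_nonneg _) (norm_nonneg _)).1 (by exact_mod_cast h)

theorem tomitaJ_apply_Ω {x : H →L[ℂ] H} (hx : x ∈ wStar (Set.range X)) :
    tomitaJ X Ω (x Ω) = star x Ω := by
  refine hX.denseRange_polyVec.eq_of_inner_left ℂ ?_
  intro q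
  rw [hX.inner_tomitaJ_left, hX.tomitaJ_polyVec, polyVec_apply, polyVec_apply,
    lift_starPoly hX.selfAdjoint]
  have h := hX.tracial _ (lift_mem_wStar X q) _ hx
  simp only [mul_apply_eq_comp, ContinuousLinearMap.star_eq_adjoint,
      ContinuousLinearMap.adjoint_inner_left] at h ⊢
  exact h

theorem tomitaJ_eq_self {f : H} (hf : IsL2SelfAdjoint X Ω f) : tomitaJ X Ω f = f := by
  have hcl : IsClosed {w : H × H | tomitaJ X Ω w.1 = w.2} :=
    isClosed_eq (by fun_prop) (by fun_prop)
  refine hcl.closure_subset_iff.2 ?_ hf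
  rintro _ ⟨x, hx, rfl⟩
  exact hX.tomitaJ_apply_Ω hx

theorem rmul_apply_Ω {a : H →L[ℂ] H} (ha : a ∈ wStar (Set.range X))
    {x : H →L[ℂ] H} (hx : x ∈ wStar (Set.range X)) : rmul X Ω a (x Ω) = x (a Ω) := by
  have h : star a * star x ∈ wStar (Set.range X) := mul_mem (star_mem ha) (star_mem hx)
  have h1 := hX.tomitaJ_apply_Ω h
  rw [star_mul, star_star, star_star] at h1
  rw [rmul_apply, hX.tomitaJ_apply_Ω hx]
  exact h1

theorem rmul_Ω {a : H →L[ℂ] H} (ha : a ∈ wStar (Set.range X)) : rmul X Ω a Ω = a Ω := by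
  simpa using hX.rmul_apply_Ω ha (one_mem _)

theorem isRightMul_rmul {a : H →L[ℂ] H} (ha : a ∈ wStar (Set.range X)) :
    IsRightMul X Ω a (rmul X Ω a) := fun _ hx => hX.rmul_apply_Ω ha hx

theorem rmul_polyVec (p q : FreeAlgebra ℂ (Fin n)) :
    rmul X Ω (FreeAlgebra.lift ℂ X q) (polyVec X Ω p) = polyVec X Ω (p * q) := by
  rw [polyVec_mul]
  exact hX.rmul_apply_Ω (lift_mem_wStar X q) (lift_mem_wStar X p)

theorem star_rmul (a : H →L[ℂ] H) : star (rmul X Ω a) = rmul X Ω (star a) := by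
  rw [ContinuousLinearMap.star_eq_adjoint]
  symm
  rw [ContinuousLinearMap.eq_adjoint_iff]
  intro u v
  rw [rmul_apply, rmul_apply, star_star, hX.inner_tomitaJ_left, hX.inner_tomitaJ,
    ContinuousLinearMap.star_eq_adjoint, ContinuousLinearMap.adjoint_inner_left]

/-- A right multiplication operator commutes with `M`. -/
theorem commute_of_isRightMul {b R : H →L[ℂ] H} (hR : IsRightMul X Ω b R) {x : H →L[ℂ] H}
    (hx : x ∈ wStar (Set.range X)) : Commute x R := by
  ext v
  change x (R v) = R (x v)
  induction v using hX.denseRange_polyVec.induction_on with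
  | hp => exact isClosed_eq (by fun_prop) (by fun_prop)
  | ih p =>
    have h1 := hR _ (lift_mem_wStar X p)
    have h2 := hR _ (mul_mem hx (lift_mem_wStar X p))
    rw [polyVec_apply, h1]
    exact h2.symm

theorem commute_rmul {a : H →L[ℂ] H} (ha : a ∈ wStar (Set.range X)) {x : H →L[ℂ] H}
    (hx : x ∈ wStar (Set.range X)) : Commute x (rmul X Ω a) :=
  hX.commute_of_isRightMul (hX.isRightMul_rmul ha) hx

/-- Right multiplication on the left leg and left multiplication on the right leg
(`commute_tensorOp_rightLeg`) are the only parts of the commutant of M ⊗̄ Mᵒᵖ that are needed: they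
reduce the action of a Jacobian entry on p ⊗ 1 or 1 ⊗ p to its action on 1 ⊗ 1. -/
theorem commute_tensorOp_leftLeg_rmul {T : HTensor H →L[ℂ] HTensor H} (hT : T ∈ tensorOp X Ω)
    {a : H →L[ℂ] H} (ha : a ∈ wStar (Set.range X)) : Commute (leftLeg (rmul X Ω a)) T := by
  refine mem_wStar_iff.1 hT _ ?_
  rintro _ (⟨m, hm, rfl⟩ | ⟨b, _, R, _, rfl⟩)
  · rw [star_leftLeg]
    exact ⟨Commute.leftLeg (hX.commute_rmul ha hm),
      Commute.leftLeg (hX.commute_rmul ha (star_mem hm))⟩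
  · rw [star_rightLeg]
    exact ⟨(commute_leftLeg_rightLeg _ _).symm, (commute_leftLeg_rightLeg _ _).symm⟩

theorem commute_tensorOp_rightLeg {T : HTensor H →L[ℂ] HTensor H} (hT : T ∈ tensorOp X Ω)
    {a : H →L[ℂ] H} (ha : a ∈ wStar (Set.range X)) : Commute (rightLeg a) T := by
  refine mem_wStar_iff.1 hT _ ?_
  rintro _ (⟨m, hm, rfl⟩ | ⟨b, _, R, hR, rfl⟩)
  · rw [star_leftLeg]
    exact ⟨commute_leftLeg_rightLeg _ _, commute_leftLeg_rightLeg _ _⟩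
  · rw [star_rightLeg]
    refine ⟨Commute.rightLeg (hX.commute_of_isRightMul hR ha).symm, Commute.rightLeg ?_⟩
    exact (commute_star_comm.1 (hX.commute_of_isRightMul hR (star_mem ha))).symm

end IsTracialTuple

end WStar

/-! ### Free difference quotients of polynomials -/

section DQ

variable {n : ℕ} {H : Type*} [NormedAddCommGroup H] [InnerProductSpace ℂ H]
  {X : Fin n → H →L[ℂ] H} {Ω : H}

/-- Evaluation of `ℂ⟨t⟩ ⊗ ℂ⟨t⟩` in `L²(M) ⊗̄ L²(M)`. -/
def tensorVec (X : Fin n → H →L[ℂ] H) (Ω : H) :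
    FreeAlgebra ℂ (Fin n) ⊗[ℂ] FreeAlgebra ℂ (Fin n) →ₗ[ℂ] HTensor H :=
  (UniformSpace.Completion.toComplL (𝕜 := ℂ) (E := H ⊗[ℂ] H)).toLinearMap ∘ₗ
    TensorProduct.map (polyVec X Ω) (polyVec X Ω)

theorem tensorVec_tmul (p q : FreeAlgebra ℂ (Fin n)) :
    tensorVec X Ω (p ⊗ₜ q) = htmul (polyVec X Ω p) (polyVec X Ω q) := rfl

theorem dqVec_apply (j : Fin n) (p : FreeAlgebra ℂ (Fin n)) :
    dqVec X Ω j p = tensorVec X Ω (formalDQ j p) := rfl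

theorem tensorVec_tmul_one_mul (p : FreeAlgebra ℂ (Fin n))
    (z : FreeAlgebra ℂ (Fin n) ⊗[ℂ] FreeAlgebra ℂ (Fin n)) :
    tensorVec X Ω ((p ⊗ₜ 1) * z) = leftLeg (FreeAlgebra.lift ℂ X p) (tensorVec X Ω z) := by
  induction z using TensorProduct.induction_on with
  | zero => simp
  | tmul a b =>
    rw [Algebra.TensorProduct.tmul_mul_tmul, one_mul, tensorVec_tmul, tensorVec_tmul,
      leftLeg_htmul, polyVec_mul]
  | add x y hx hy => rw [mul_add, map_add, hx, hy, map_add, map_add]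

theorem formalDQ_one (j : Fin n) : formalDQ j (1 : FreeAlgebra ℂ (Fin n)) = 0 := by
  have h := formalDQ_mul j (1 : FreeAlgebra ℂ (Fin n)) 1
  rw [← Algebra.TensorProduct.one_def, one_mul, one_mul, mul_one] at h
  exact left_eq_add.1 h

theorem dqVec_one (j : Fin n) : dqVec X Ω j 1 = 0 := by
  rw [dqVec_apply, formalDQ_one, map_zero]

theorem dqVec_algebraMap (j : Fin n) (r : ℂ) :
    dqVec X Ω j (algebraMap ℂ _ r) = 0 := by
  rw [Algebra.algebraMap_eq_smul_one, map_smul, dqVec_one, smul_zero]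

theorem dqVec_ι_mul (j k : Fin n) (p : FreeAlgebra ℂ (Fin n)) :
    dqVec X Ω j (FreeAlgebra.ι ℂ k * p) =
      leftLeg (X k) (dqVec X Ω j p) + if k = j then htmul Ω (polyVec X Ω p) else 0 := by
  rw [dqVec_apply, formalDQ_mul, map_add, tensorVec_tmul_one_mul, FreeAlgebra.lift_ι_apply,
    formalDQ_ι, dqVec_apply]
  congr 1
  split_ifs with h
  · rw [Algebra.TensorProduct.tmul_mul_tmul, one_mul, one_mul, tensorVec_tmul, polyVec_one]
  · rw [zero_mul, map_zero]

theorem dqVec_ι (j k : Fin n) :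
    dqVec X Ω j (FreeAlgebra.ι ℂ k) = if k = j then htmul Ω Ω else 0 := by
  have h := dqVec_ι_mul (X := X) (Ω := Ω) j k 1
  rwa [mul_one, dqVec_one, map_zero, zero_add, polyVec_one] at h

/-- The formal map `(1 ⊗ τ) ∂ⱼ` on noncommutative polynomials. -/
def rightTraceDQ (X : Fin n → H →L[ℂ] H) (Ω : H) (j : Fin n) :
    FreeAlgebra ℂ (Fin n) →ₗ[ℂ] FreeAlgebra ℂ (Fin n) :=
  (TensorProduct.rid ℂ (FreeAlgebra ℂ (Fin n))).toLinearMap ∘ₗ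
    TensorProduct.map LinearMap.id ((innerSL ℂ Ω).toLinearMap ∘ₗ polyVec X Ω) ∘ₗ formalDQ j

theorem rightTraceDQ_one (j : Fin n) : rightTraceDQ X Ω j 1 = 0 := by
  simp [rightTraceDQ, formalDQ_one]

theorem rightTraceDQ_ι_mul (j k : Fin n) (p : FreeAlgebra ℂ (Fin n)) :
    rightTraceDQ X Ω j (FreeAlgebra.ι ℂ k * p) =
      FreeAlgebra.ι ℂ k * rightTraceDQ X Ω j p +
        if k = j then ⟪Ω, polyVec X Ω p⟫_ℂ • 1 else 0 := by
  have key : ∀ z : FreeAlgebra ℂ (Fin n) ⊗[ℂ] FreeAlgebra ℂ (Fin n),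
      TensorProduct.rid ℂ (FreeAlgebra ℂ (Fin n)) (TensorProduct.map LinearMap.id
        ((innerSL ℂ Ω).toLinearMap ∘ₗ polyVec X Ω) ((FreeAlgebra.ι ℂ k ⊗ₜ 1) * z)) =
      FreeAlgebra.ι ℂ k * TensorProduct.rid ℂ (FreeAlgebra ℂ (Fin n))
        (TensorProduct.map LinearMap.id ((innerSL ℂ Ω).toLinearMap ∘ₗ polyVec X Ω) z) := by
    intro z
    induction z using TensorProduct.induction_on with
    | zero => simp
    | tmul a b => simp [Algebra.TensorProduct.tmul_mul_tmul]
    | add x y hx hy => rw [mul_add, map_add, map_add, hx, hy, map_add, map_add, mul_add]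
  simp only [rightTraceDQ, LinearMap.comp_apply, LinearEquiv.coe_coe, formalDQ_mul, map_add, key,
    formalDQ_ι]
  congr 1
  split_ifs <;> simp [Algebra.TensorProduct.tmul_mul_tmul]

variable [CompleteSpace H]

theorem polyVec_rightTraceDQ (j : Fin n) (p : FreeAlgebra ℂ (Fin n)) :
    polyVec X Ω (rightTraceDQ X Ω j p) = contrR Ω (dqVec X Ω j p) := by
  rw [dqVec_apply]
  simp only [rightTraceDQ, LinearMap.comp_apply, LinearEquiv.coe_coe]
  generalize formalDQ j p = z
  induction z using TensorProduct.induction_on with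
  | zero => simp
  | tmul a b => simp [tensorVec_tmul, contrR_htmul]
  | add x y hx hy => rw [map_add, map_add, map_add, hx, hy, map_add, map_add]

namespace IsTracialTuple

variable (hX : IsTracialTuple X Ω)
include hX

theorem tensorVec_mul_one_tmul (q : FreeAlgebra ℂ (Fin n))
    (z : FreeAlgebra ℂ (Fin n) ⊗[ℂ] FreeAlgebra ℂ (Fin n)) :
    tensorVec X Ω (z * (1 ⊗ₜ q)) =
      rightLeg (rmul X Ω (FreeAlgebra.lift ℂ X q)) (tensorVec X Ω z) := by
  induction z using TensorProduct.induction_on with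
  | zero => simp
  | tmul a b =>
    rw [Algebra.TensorProduct.tmul_mul_tmul, mul_one, tensorVec_tmul, tensorVec_tmul,
      rightLeg_htmul, hX.rmul_polyVec]
  | add x y hx hy => rw [add_mul, map_add, hx, hy, map_add, map_add]

theorem dqVec_mul (j : Fin n) (p q : FreeAlgebra ℂ (Fin n)) :
    dqVec X Ω j (p * q) = leftLeg (FreeAlgebra.lift ℂ X p) (dqVec X Ω j q) +
      rightLeg (rmul X Ω (FreeAlgebra.lift ℂ X q)) (dqVec X Ω j p) := by
  rw [dqVec_apply, formalDQ_mul, map_add, tensorVec_tmul_one_mul, hX.tensorVec_mul_one_tmul,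
    dqVec_apply, dqVec_apply]

theorem star_rmul_lift_tomitaJ (p : FreeAlgebra ℂ (Fin n)) (x : H) :
    star (rmul X Ω (FreeAlgebra.lift ℂ X p)) (tomitaJ X Ω x) =
      tomitaJ X Ω (FreeAlgebra.lift ℂ X p x) := by
  rw [hX.star_rmul, rmul_apply, hX.tomitaJ_tomitaJ, star_star]

/-- The difference quotients are real: `∂ⱼ(p*)` is obtained from `∂ⱼ p` by applying `J` to both
legs and flipping them. -/
theorem inner_dqVec_starPoly (j : Fin n) (p : FreeAlgebra ℂ (Fin n)) (x y : H) :
    ⟪htmul x y, dqVec X Ω j (starPoly p)⟫_ℂ =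
      ⟪dqVec X Ω j p, htmul (tomitaJ X Ω y) (tomitaJ X Ω x)⟫_ℂ := by
  induction p using FreeAlgebra.induction generalizing x y with
  | grade0 r => simp only [starPoly_algebraMap, dqVec_algebraMap, inner_zero_right,
      inner_zero_left]
  | grade1 k =>
    rw [starPoly_ι, dqVec_ι]
    split_ifs with h
    · rw [inner_htmul, inner_htmul, hX.inner_tomitaJ, hX.inner_tomitaJ Ω x, hX.tomitaJ_Ω, mul_comm]
    · simp
  | mul a b ha hb =>
    rw [starPoly_mul, hX.dqVec_mul, hX.dqVec_mul, inner_add_right, inner_add_left,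
      inner_htmul_leftLeg, inner_htmul_rightLeg, ha, hb, lift_starPoly hX.selfAdjoint, star_star,
      lift_starPoly hX.selfAdjoint, hX.star_rmul, star_star]
    rw [← inner_conj_symm (leftLeg _ _), ← inner_conj_symm (rightLeg _ _), inner_htmul_leftLeg,
      inner_htmul_rightLeg, inner_conj_symm, inner_conj_symm, hX.star_rmul_lift_tomitaJ, add_comm,
      rmul_apply, hX.tomitaJ_tomitaJ]
  | add a b ha hb => rw [starPoly_add, map_add, map_add, inner_add_right, inner_add_left, ha, hb]

/-- Injectivity of p ↦ p(X)Ω makes the defining range single-valued, so that `toLinearPMap` has it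
as its graph. -/
theorem mem_graph_freeDQ_iff (j : Fin n) (w : H × HTensor H) :
    w ∈ (freeDQ X Ω j).graph ↔ ∃ p, (polyVec X Ω p, dqVec X Ω j p) = w := by
  rw [freeDQ, Submodule.toLinearPMap_graph_eq]
  · rfl
  · rintro _ ⟨p, rfl⟩ h
    have : p = 0 := hX.polyVec_injective (by simpa using h)
    simp [this]

theorem freeDQ_apply (j : Fin n) (p : FreeAlgebra ℂ (Fin n)) (h) :
    freeDQ X Ω j ⟨polyVec X Ω p, h⟩ = dqVec X Ω j p := by
  have h1 := (hX.mem_graph_freeDQ_iff j (polyVec X Ω p, dqVec X Ω j p)).2 ⟨p, rfl⟩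
  exact ((LinearPMap.image_iff h).2 h1).symm

theorem freeDQ_domain (j : Fin n) :
    (freeDQ X Ω j).domain = LinearMap.range (polyVec X Ω) := by
  ext v
  constructor
  · intro hv
    obtain ⟨p, hp⟩ := (hX.mem_graph_freeDQ_iff j _).1
      (LinearPMap.mem_graph (freeDQ X Ω j) ⟨v, hv⟩)
    exact ⟨p, congrArg Prod.fst hp⟩
  · rintro ⟨p, rfl⟩
    exact polyVec_mem_domain X Ω j p

theorem dense_domain_freeDQ (j : Fin n) : Dense ((freeDQ X Ω j).domain : Set H) := by
  rw [hX.freeDQ_domain]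
  exact hX.denseRange_polyVec

/-- A closed condition that holds on the graph of `∂ⱼ` holds on the graph of `∂̄ⱼ`. -/
theorem closure_graph_induction {j : Fin n} (hj : (freeDQ X Ω j).IsClosable)
    {P : H × HTensor H → Prop} (hc : IsClosed {w | P w})
    (hp : ∀ p, P (polyVec X Ω p, dqVec X Ω j p)) {w : H × HTensor H}
    (hw : w ∈ (freeDQ X Ω j).closure.graph) : P w := by
  rw [← hj.graph_closure_eq_closure_graph] at hw
  refine hc.closure_subset_iff.2 ?_ (show w ∈ closure _ from hw)
  intro v hv
  obtain ⟨p, rfl⟩ := (hX.mem_graph_freeDQ_iff j v).1 hv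
  exact hp p

/-- The defining property of a conjugate variable. -/
theorem inner_conjugate {j : Fin n} {ξ : H} (hξ : (htmul Ω Ω, ξ) ∈ (freeDQ X Ω j)†.graph)
    (p : FreeAlgebra ℂ (Fin n)) :
    ⟪ξ, polyVec X Ω p⟫_ℂ = ⟪htmul Ω Ω, dqVec X Ω j p⟫_ℂ := by
  obtain ⟨y, hy1, hy2⟩ := (LinearPMap.mem_graph_iff _).1 hξ
  have h := LinearPMap.adjoint_isFormalAdjoint (hX.dense_domain_freeDQ j) y
    ⟨polyVec X Ω p, polyVec_mem_domain X Ω j p⟩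
  rw [hX.freeDQ_apply, hy2, hy1] at h
  exact h

/-- A consequence of the reality of ∂_j, since 1 ⊗ 1 is fixed by the flip composed with J on both
legs. -/
theorem tomitaJ_conjugate {j : Fin n} {ξ : H} (hξ : (htmul Ω Ω, ξ) ∈ (freeDQ X Ω j)†.graph) :
    tomitaJ X Ω ξ = ξ := by
  refine hX.denseRange_polyVec.eq_of_inner_left ℂ fun p => ?_
  rw [hX.inner_tomitaJ_left, hX.tomitaJ_polyVec, ← inner_conj_symm, hX.inner_conjugate hξ,
    hX.inner_conjugate hξ, hX.inner_dqVec_starPoly, inner_conj_symm, hX.tomitaJ_Ω]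

/-- Coassociativity of the difference quotients, paired with a conjugate variable. -/
theorem inner_dqVec_rightTraceDQ (i : Fin n) {j : Fin n} {ξ : H}
    (hξ : (htmul Ω Ω, ξ) ∈ (freeDQ X Ω j)†.graph) (b : FreeAlgebra ℂ (Fin n)) (x : H) :
    ⟪htmul x Ω, dqVec X Ω i (rightTraceDQ X Ω j b)⟫_ℂ = ⟪ξ, contrL x (dqVec X Ω i b)⟫_ℂ := by
  induction b using freeAlgebra_induction_left generalizing x with
  | h1 => simp [rightTraceDQ_one, dqVec_one]
  | hadd p q hp hq => simp only [map_add, inner_add_right, hp, hq]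
  | hsmul c p hp => simp only [map_smul, inner_smul_right, hp]
  | hmul k p hp =>
    have h1 : contrL x (leftLeg (X k) (dqVec X Ω i p)) = contrL (X k x) (dqVec X Ω i p) := by
      refine ext_inner_left ℂ fun y => ?_
      rw [inner_contrL, inner_contrL, inner_htmul_leftLeg, (hX.selfAdjoint k).star_eq]
    -- The extra Leibniz term of (1 ⊗ τ)∂_j is a scalar, which ∂_i kills.
    have h2 : dqVec X Ω i (if k = j then ⟪Ω, polyVec X Ω p⟫_ℂ • 1 else 0) = 0 := by
      split_ifs <;> simp [dqVec_one]
    rw [rightTraceDQ_ι_mul, map_add, h2, add_zero, dqVec_ι_mul, dqVec_ι_mul, map_add, h1,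
      inner_add_right, inner_add_right, inner_htmul_leftLeg, (hX.selfAdjoint k).star_eq, hp]
    congr 1
    split_ifs with h
    · rw [contrL_htmul, inner_htmul, inner_smul_right, hX.inner_conjugate hξ,
        polyVec_rightTraceDQ, inner_contrR]
    · simp

end IsTracialTuple

end DQ

/-! ### Creation and annihilation operators -/

section Creation

variable {n : ℕ} {H : Type*} [NormedAddCommGroup H] [InnerProductSpace ℂ H]
  {X : Fin n → H →L[ℂ] H} {Ω : H} {ξ : Fin n → H}

/-- The map `a ↦ ∂ⱼ*(a ⊗ 1) = a ξⱼ - (1 ⊗ τ) ∂ⱼ a` on polynomials. -/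
def adjointDQ (X : Fin n → H →L[ℂ] H) (Ω : H) (ξ : Fin n → H) (j : Fin n) :
    FreeAlgebra ℂ (Fin n) →ₗ[ℂ] H :=
  polyVec X (ξ j) - polyVec X Ω ∘ₗ rightTraceDQ X Ω j

theorem adjointDQ_apply (j : Fin n) (a : FreeAlgebra ℂ (Fin n)) :
    adjointDQ X Ω ξ j a =
      FreeAlgebra.lift ℂ X a (ξ j) - polyVec X Ω (rightTraceDQ X Ω j a) := rfl

/-- The bounded extension of `a ↦ ∂ⱼ*(a ⊗ 1)` to `L²(M)`. -/
def creation (X : Fin n → H →L[ℂ] H) (Ω : H) (ξ : Fin n → H) [CompleteSpace H] (j : Fin n) :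
    H →L[ℂ] H :=
  (adjointDQ X Ω ξ j).extendOfNorm (polyVec X Ω)

/-- The bounded extension of `(1 ⊗ τ) ∂ⱼ` to `L²(M)`. -/
def annihilation (X : Fin n → H →L[ℂ] H) (Ω : H) (ξ : Fin n → H) [CompleteSpace H] (j : Fin n) :
    H →L[ℂ] H :=
  (creation X Ω ξ j).adjoint

variable [CompleteSpace H] {Jac : Matrix (Fin n) (Fin n) (HTensor H →L[ℂ] HTensor H)}

/-- Integration by parts: ⟨aξ_j, p⟩ = ⟨1 ⊗ 1, ∂_j(a*p)⟩, and Leibniz produces a term in ∂_j(a*)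
which, by reality of ∂_j, is the correction (1 ⊗ τ)∂_j a. -/
theorem IsTracialTuple.inner_adjointDQ (hX : IsTracialTuple X Ω) {j : Fin n}
    (hξ : (htmul Ω Ω, ξ j) ∈ (freeDQ X Ω j)†.graph) (a p : FreeAlgebra ℂ (Fin n)) :
    ⟪adjointDQ X Ω ξ j a, polyVec X Ω p⟫_ℂ = ⟪htmul (polyVec X Ω a) Ω, dqVec X Ω j p⟫_ℂ := by
  have h1 : ⟪FreeAlgebra.lift ℂ X a (ξ j), polyVec X Ω p⟫_ℂ =
      ⟪ξ j, polyVec X Ω (starPoly a * p)⟫_ℂ := by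
    rw [polyVec_mul, lift_starPoly hX.selfAdjoint, ContinuousLinearMap.star_eq_adjoint,
      ContinuousLinearMap.adjoint_inner_right]
  have h2 : star (rmul X Ω (FreeAlgebra.lift ℂ X p)) Ω = tomitaJ X Ω (polyVec X Ω p) := by
    have := hX.star_rmul_lift_tomitaJ p Ω
    rwa [hX.tomitaJ_Ω] at this
  rw [adjointDQ_apply, inner_sub_left, h1, hX.inner_conjugate hξ, hX.dqVec_mul, inner_add_right,
    inner_htmul_leftLeg, inner_htmul_rightLeg, h2, hX.inner_dqVec_starPoly, hX.tomitaJ_tomitaJ,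
    hX.tomitaJ_Ω, lift_starPoly hX.selfAdjoint, star_star, ← polyVec_apply,
    polyVec_rightTraceDQ, ← inner_conj_symm (contrR _ _), inner_contrR, inner_conj_symm,
    add_sub_cancel_right]

variable (hX : IsTracialTuple X Ω) (hL : IsLipschitzConjugate X Ω ξ Jac)
include hX hL

/-- Since ξ_j lies only in the domain of the closure, Leibniz for ∂_i(bw) is used for polynomial w
and carried over to the closed graph. J puts the term containing ∂_i b into a form continuous in w.
-/
theorem inner_adjointDQ_lift_conjugate (i j : Fin n) (a b : FreeAlgebra ℂ (Fin n)) :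
    ⟪adjointDQ X Ω ξ i a, FreeAlgebra.lift ℂ X b (ξ j)⟫_ℂ =
      ⟪htmul (polyVec X Ω a) Ω, leftLeg (FreeAlgebra.lift ℂ X b) (Jac j i (htmul Ω Ω))⟫_ℂ +
        ⟪ξ j, contrL (polyVec X Ω a) (dqVec X Ω i b)⟫_ℂ := by
  have key := hX.closure_graph_induction (hL.closable i) (P := fun w =>
    ⟪adjointDQ X Ω ξ i a, FreeAlgebra.lift ℂ X b w.1⟫_ℂ =
      ⟪htmul (polyVec X Ω a) Ω, leftLeg (FreeAlgebra.lift ℂ X b) w.2⟫_ℂ +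
        ⟪tomitaJ X Ω (contrL (polyVec X Ω a) (dqVec X Ω i b)), w.1⟫_ℂ)
    (isClosed_eq (by fun_prop) (by fun_prop)) ?_ (hL.jacobian j i)
  · simp only at key
    rw [key, hX.inner_tomitaJ_left, hX.tomitaJ_conjugate (hL.conjugate j)]
  · intro p
    have h2 : star (rmul X Ω (FreeAlgebra.lift ℂ X p)) Ω = tomitaJ X Ω (polyVec X Ω p) := by
      have := hX.star_rmul_lift_tomitaJ p Ω
      rwa [hX.tomitaJ_Ω] at this
    simp only
    rw [← polyVec_mul, hX.inner_adjointDQ (hL.conjugate i), hX.dqVec_mul, inner_add_right,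
      inner_htmul_rightLeg, h2, hX.inner_tomitaJ_left, inner_contrL]

/-- The term in ∂_i b occurs twice, in ⟨A_i a, bξ_j⟩ and, by coassociativity, in ⟨A_i a, (1 ⊗ τ)∂_j
b⟩. The two cancel and only the Jacobian remains, which gives both the boundedness of A_j and its
lower bound under CD(1,∞). -/
theorem inner_adjointDQ_adjointDQ (i j : Fin n) (a b : FreeAlgebra ℂ (Fin n)) :
    ⟪adjointDQ X Ω ξ i a, adjointDQ X Ω ξ j b⟫_ℂ =
      ⟪htmul (tomitaJ X Ω (polyVec X Ω b)) Ω,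
        Jac j i (htmul (tomitaJ X Ω (polyVec X Ω a)) Ω)⟫_ℂ := by
  have h1 : htmul (tomitaJ X Ω (polyVec X Ω a)) Ω =
      leftLeg (rmul X Ω (FreeAlgebra.lift ℂ X (starPoly a))) (htmul Ω Ω) := by
    rw [leftLeg_htmul, hX.tomitaJ_polyVec, hX.rmul_Ω (lift_mem_wStar X _), polyVec_apply]
  have h2 : Jac j i (htmul (tomitaJ X Ω (polyVec X Ω a)) Ω) =
      leftLeg (rmul X Ω (FreeAlgebra.lift ℂ X (starPoly a))) (Jac j i (htmul Ω Ω)) := by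
    rw [h1]
    exact (DFunLike.congr_fun (hX.commute_tensorOp_leftLeg_rmul (hL.jacobian_mem j i)
      (lift_mem_wStar X (starPoly a))).eq (htmul Ω Ω)).symm
  rw [h2, adjointDQ_apply _ b, inner_sub_right, inner_adjointDQ_lift_conjugate hX hL,
    hX.inner_adjointDQ (hL.conjugate i), hX.inner_dqVec_rightTraceDQ i (hL.conjugate j),
    add_sub_cancel_right, inner_htmul_leftLeg, inner_htmul_leftLeg, hX.star_rmul,
    lift_starPoly hX.selfAdjoint, star_star, hX.tomitaJ_polyVec, hX.rmul_polyVec, polyVec_mul,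
    lift_starPoly hX.selfAdjoint]

theorem norm_adjointDQ_le (j : Fin n) (a : FreeAlgebra ℂ (Fin n)) :
    ‖adjointDQ X Ω ξ j a‖ ≤ √‖Jac j j‖ * ‖polyVec X Ω a‖ := by
  have h : ‖adjointDQ X Ω ξ j a‖ ^ 2 ≤ ‖Jac j j‖ * ‖polyVec X Ω a‖ ^ 2 := by
    have hn : ‖htmul (tomitaJ X Ω (polyVec X Ω a)) Ω‖ = ‖polyVec X Ω a‖ := by
      rw [norm_htmul, hX.norm_tomitaJ, hX.norm_one, mul_one]
    calc ‖adjointDQ X Ω ξ j a‖ ^ 2 = ‖⟪adjointDQ X Ω ξ j a, adjointDQ X Ω ξ j a⟫_ℂ‖ := by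
          rw [inner_self_eq_norm_sq_to_K]; simp
      _ ≤ ‖polyVec X Ω a‖ * (‖Jac j j‖ * ‖polyVec X Ω a‖) := by
          rw [inner_adjointDQ_adjointDQ hX hL]
          refine (norm_inner_le_norm _ _).trans ?_
          rw [hn]
          gcongr
          refine (ContinuousLinearMap.le_opNorm _ _).trans ?_
          rw [hn]
      _ = _ := by ring
  have hs : √‖Jac j j‖ ^ 2 = ‖Jac j j‖ := Real.sq_sqrt (ContinuousLinearMap.opNorm_nonneg _)
  refine le_of_sq_le_sq ?_ (by positivity)
  rw [mul_pow, hs]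
  exact h

theorem creation_polyVec (j : Fin n) (a : FreeAlgebra ℂ (Fin n)) :
    creation X Ω ξ j (polyVec X Ω a) = adjointDQ X Ω ξ j a :=
  LinearMap.extendOfNorm_eq hX.denseRange_polyVec ⟨_, norm_adjointDQ_le hX hL j⟩ a

theorem creation_Ω (j : Fin n) : creation X Ω ξ j Ω = ξ j := by
  have h := creation_polyVec hX hL j 1
  rw [polyVec_one, adjointDQ_apply, rightTraceDQ_one] at h
  simpa using h

theorem annihilation_polyVec (j : Fin n) (p : FreeAlgebra ℂ (Fin n)) :
    annihilation X Ω ξ j (polyVec X Ω p) = contrR Ω (dqVec X Ω j p) := by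
  refine hX.denseRange_polyVec.eq_of_inner_right ℂ fun a => ?_
  rw [annihilation, ContinuousLinearMap.adjoint_inner_right, creation_polyVec hX hL,
    hX.inner_adjointDQ (hL.conjugate j), inner_contrR]

theorem annihilation_Ω (j : Fin n) : annihilation X Ω ξ j Ω = 0 := by
  have h := annihilation_polyVec hX hL j 1
  rwa [polyVec_one, dqVec_one, map_zero] at h

theorem annihilation_of_mem_closure_graph {j : Fin n} {w : H × HTensor H}
    (hw : w ∈ (freeDQ X Ω j).closure.graph) : annihilation X Ω ξ j w.1 = contrR Ω w.2 :=
  hX.closure_graph_induction (hL.closable j)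
    (P := fun w => annihilation X Ω ξ j w.1 = contrR Ω w.2)
    (isClosed_eq (by fun_prop) (by fun_prop)) (annihilation_polyVec hX hL j) hw

/-- By reality of ∂_j, conjugation by J exchanges the two partial traces, so (τ ⊗ 1)∂_j is bounded
as well. -/
theorem tomitaJ_annihilation_tomitaJ_polyVec (j : Fin n) (p : FreeAlgebra ℂ (Fin n)) :
    tomitaJ X Ω (annihilation X Ω ξ j (tomitaJ X Ω (polyVec X Ω p))) =
      contrL Ω (dqVec X Ω j p) := by
  refine ext_inner_left ℂ fun y => ?_
  rw [hX.inner_tomitaJ, hX.tomitaJ_polyVec, annihilation_polyVec hX hL, ← inner_conj_symm,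
    inner_contrR, hX.inner_dqVec_starPoly, hX.tomitaJ_Ω, hX.tomitaJ_tomitaJ, inner_conj_symm,
    inner_contrL]

theorem tomitaJ_annihilation_of_mem_closure_graph {j : Fin n} {w : H × HTensor H}
    (hw : w ∈ (freeDQ X Ω j).closure.graph) :
    tomitaJ X Ω (annihilation X Ω ξ j (tomitaJ X Ω w.1)) = contrL Ω w.2 :=
  hX.closure_graph_induction (hL.closable j)
    (P := fun w => tomitaJ X Ω (annihilation X Ω ξ j (tomitaJ X Ω w.1)) = contrL Ω w.2)
    (isClosed_eq (by fun_prop) (by fun_prop)) (tomitaJ_annihilation_tomitaJ_polyVec hX hL j) hw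

/-- Leibniz for ∂_j(t_k p) adds only δ_jk 1 ⊗ p, whose right trace is scalar. This rank-one
commutator makes the joint kernel almost invariant under the generators. -/
theorem annihilation_generator_apply (j k : Fin n) (v : H) :
    annihilation X Ω ξ j (X k v) =
      X k (annihilation X Ω ξ j v) + if k = j then ⟪Ω, v⟫_ℂ • Ω else 0 := by
  induction v using hX.denseRange_polyVec.induction_on with
  | hp =>
    refine isClosed_eq (by fun_prop) ?_
    split_ifs <;> fun_prop
  | ih p =>
    rw [← polyVec_ι_mul, annihilation_polyVec hX hL, annihilation_polyVec hX hL,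
      ← polyVec_rightTraceDQ, ← polyVec_rightTraceDQ, rightTraceDQ_ι_mul, map_add, polyVec_ι_mul]
    congr 1
    split_ifs
    · rw [map_smul, polyVec_one]
    · rw [map_zero]

/-- The curvature condition bounds the row of creation operators from below. -/
theorem sum_norm_sq_le_norm_sum_creation (hCD : CurvatureDimension 1 Jac) (η : Fin n → H) :
    ∑ j, ‖η j‖ ^ 2 ≤ ‖∑ j, creation X Ω ξ j (η j)‖ ^ 2 := by
  have hd : DenseRange (Pi.map fun (_ : Fin n) => ⇑(polyVec X Ω)) :=
    DenseRange.piMap fun _ => hX.denseRange_polyVec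
  induction η using hd.induction_on with
  | hp => exact isClosed_le (by fun_prop) (by fun_prop)
  | ih a =>
    have h := hCD fun j => htmul (tomitaJ X Ω (polyVec X Ω (a j))) Ω
    have h2 : ∑ i, ∑ j, ⟪htmul (tomitaJ X Ω (polyVec X Ω (a i))) Ω,
        Jac i j (htmul (tomitaJ X Ω (polyVec X Ω (a j))) Ω)⟫_ℂ =
        ⟪∑ j, adjointDQ X Ω ξ j (a j), ∑ j, adjointDQ X Ω ξ j (a j)⟫_ℂ := by
      simp_rw [← inner_adjointDQ_adjointDQ hX hL, sum_inner, inner_sum]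
      exact Finset.sum_comm
    rw [h2] at h
    simp only [norm_htmul, hX.norm_tomitaJ, hX.norm_one, mul_one, one_mul] at h
    simp only [Pi.map_apply, creation_polyVec hX hL]
    have h3 := (Complex.le_def.1 h).1
    rw [Complex.ofReal_re] at h3
    exact h3.trans_eq (inner_self_eq_norm_sq (𝕜 := ℂ) _)

end Creation

/-! ### The joint kernel of the annihilation operators -/

section Kernel

variable {n : ℕ} {H : Type*} [NormedAddCommGroup H] [InnerProductSpace ℂ H] [CompleteSpace H]
  {X : Fin n → H →L[ℂ] H} {Ω : H} {ξ : Fin n → H}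
  {Jac : Matrix (Fin n) (Fin n) (HTensor H →L[ℂ] HTensor H)}

theorem contrR_leftLeg (a : H →L[ℂ] H) (y : H) (z : HTensor H) :
    contrR y (leftLeg a z) = a (contrR y z) := by
  refine ext_inner_left ℂ fun x => ?_
  rw [inner_contrR, inner_htmul_leftLeg, ← inner_contrR, ContinuousLinearMap.star_eq_adjoint,
    ContinuousLinearMap.adjoint_inner_left]

/-- The centered vectors that are killed by all annihilation operators. -/
def centeredKernel (X : Fin n → H →L[ℂ] H) (Ω : H) (ξ : Fin n → H) : Submodule ℂ H :=
  LinearMap.ker (innerSL ℂ Ω).toLinearMap ⊓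
    ⨅ j, LinearMap.ker (annihilation X Ω ξ j).toLinearMap

theorem mem_centeredKernel {v : H} : v ∈ centeredKernel X Ω ξ ↔
    ⟪Ω, v⟫_ℂ = 0 ∧ ∀ j, annihilation X Ω ξ j v = 0 := by
  simp [centeredKernel, Submodule.mem_iInf]

theorem isClosed_centeredKernel : IsClosed (centeredKernel X Ω ξ : Set H) := by
  have : (centeredKernel X Ω ξ : Set H) =
      {v | ⟪Ω, v⟫_ℂ = 0} ∩ ⋂ j, {v | annihilation X Ω ξ j v = 0} := by
    ext v
    simp [mem_centeredKernel]
  rw [this]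
  exact (isClosed_eq (by fun_prop) (by fun_prop)).inter
    (isClosed_iInter fun j => isClosed_eq (by fun_prop) (by fun_prop))

instance : CompleteSpace (centeredKernel X Ω ξ) := isClosed_centeredKernel.completeSpace_coe

/-- The orthogonal projection onto the centered kernel. -/
def kernelProj (X : Fin n → H →L[ℂ] H) (Ω : H) (ξ : Fin n → H) : H →L[ℂ] H :=
  (centeredKernel X Ω ξ).starProjection

/-- The projection of the generator `Xᵢ` to the centered kernel. -/
def kernelVec (X : Fin n → H →L[ℂ] H) (Ω : H) (ξ : Fin n → H) (i : Fin n) : H :=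
  kernelProj X Ω ξ (X i Ω)

/-- The tensor `1 ⊗ JWᵢ - Wᵢ ⊗ 1`, where `Wᵢ` is the projection of `Xᵢ` to the centered kernel.
As a Hilbert-Schmidt operator it is the commutator of `Xᵢ` with that projection. -/
def kernelTensor (X : Fin n → H →L[ℂ] H) (Ω : H) (ξ : Fin n → H) (i : Fin n) : HTensor H :=
  htmul Ω (tomitaJ X Ω (kernelVec X Ω ξ i)) - htmul (kernelVec X Ω ξ i) Ω

theorem kernelProj_mem (v : H) : kernelProj X Ω ξ v ∈ centeredKernel X Ω ξ :=
  Submodule.starProjection_apply_mem _ _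

theorem kernelVec_mem (i : Fin n) : kernelVec X Ω ξ i ∈ centeredKernel X Ω ξ :=
  kernelProj_mem _

theorem kernelProj_of_mem {v : H} (hv : v ∈ centeredKernel X Ω ξ) : kernelProj X Ω ξ v = v :=
  Submodule.starProjection_eq_self_iff.2 hv

theorem inner_kernelProj (u v : H) :
    ⟪kernelProj X Ω ξ u, v⟫_ℂ = ⟪u, kernelProj X Ω ξ v⟫_ℂ :=
  Submodule.inner_starProjection_left_eq_right _ _ _

theorem kernelProj_Ω : kernelProj X Ω ξ Ω = 0 := by
  refine ext_inner_right ℂ fun v => ?_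
  rw [inner_kernelProj, (mem_centeredKernel.1 (kernelProj_mem v)).1, inner_zero_left]

variable (hX : IsTracialTuple X Ω) (hL : IsLipschitzConjugate X Ω ξ Jac)
include hX hL

/-- On centered vectors T_j commutes with X_i, so X_i P v is still killed by every T_j; removing its
Ω-component puts it back into the centered kernel. -/
theorem generator_apply_kernelProj (i : Fin n) (v : H) :
    X i (kernelProj X Ω ξ v) =
      kernelProj X Ω ξ (X i (kernelProj X Ω ξ v)) + ⟪kernelVec X Ω ξ i, v⟫_ℂ • Ω := by
  have hk := mem_centeredKernel.1 (kernelProj_mem (X := X) (Ω := Ω) (ξ := ξ) v)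
  have hin : ⟪Ω, X i (kernelProj X Ω ξ v)⟫_ℂ = ⟪kernelVec X Ω ξ i, v⟫_ℂ := by
    rw [kernelVec, inner_kernelProj]
    exact ((hX.selfAdjoint i).isSymmetric Ω _).symm
  have hmem : X i (kernelProj X Ω ξ v) - ⟪kernelVec X Ω ξ i, v⟫_ℂ • Ω ∈
      centeredKernel X Ω ξ := by
    rw [mem_centeredKernel]
    constructor
    · rw [inner_sub_right, inner_smul_right, hX.inner_self, hin, mul_one, sub_self]
    · intro j
      rw [map_sub, map_smul, annihilation_Ω hX hL, annihilation_generator_apply hX hL, hk.1, hk.2]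
      simp
  have h := kernelProj_of_mem hmem
  rw [map_sub, map_smul, kernelProj_Ω, smul_zero, sub_zero] at h
  rw [h, sub_add_cancel]

/-- The commutator of a generator with the projection onto the centered kernel has rank two. -/
theorem commutator_kernelProj (i : Fin n) (v : H) :
    kernelProj X Ω ξ (X i v) = X i (kernelProj X Ω ξ v) -
      ⟪kernelVec X Ω ξ i, v⟫_ℂ • Ω + ⟪Ω, v⟫_ℂ • kernelVec X Ω ξ i := by
  have h : kernelProj X Ω ξ (X i v) = kernelProj X Ω ξ (X i (kernelProj X Ω ξ v)) +
      ⟪Ω, v⟫_ℂ • kernelVec X Ω ξ i := by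
    refine ext_inner_left ℂ fun u => ?_
    have hs : ∀ x y, ⟪x, X i y⟫_ℂ = ⟪X i x, y⟫_ℂ := fun x y =>
      ((hX.selfAdjoint i).isSymmetric x y).symm
    rw [← inner_kernelProj, hs, generator_apply_kernelProj hX hL i u, inner_add_left,
      inner_add_right, inner_smul_left, inner_smul_right, inner_conj_symm, inner_kernelProj, ← hs,
      inner_kernelProj, mul_comm]
  rw [h, eq_sub_of_add_eq (generator_apply_kernelProj hX hL i v).symm]

/-- Up to sign this is [P, p] = ∑_j ∂_j p # [P, X_j] applied to Ω, where (a ⊗ b) # S = aSb and PΩ =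
0. The two terms come from the two rank-one pieces of [P, X_j]. -/
theorem kernelProj_polyVec (p : FreeAlgebra ℂ (Fin n)) :
    ∑ j, (contrR (kernelVec X Ω ξ j) (dqVec X Ω j p) -
      FreeAlgebra.lift ℂ X (rightTraceDQ X Ω j p) (kernelVec X Ω ξ j)) =
        - kernelProj X Ω ξ (polyVec X Ω p) := by
  induction p using freeAlgebra_induction_left with
  | h1 => simp [dqVec_one, rightTraceDQ_one, polyVec_one, kernelProj_Ω]
  | hadd p q hp hq =>
    simp only [map_add, add_apply, neg_add, ← hp, ← hq,
      ← Finset.sum_add_distrib]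
    exact Finset.sum_congr rfl fun j _ => by abel
  | hsmul c p hp =>
    simp only [map_smul, smul_apply, ← smul_neg, ← hp, Finset.smul_sum,
      smul_sub]
  | hmul k p hp =>
    have h : ∀ j, contrR (kernelVec X Ω ξ j) (dqVec X Ω j (FreeAlgebra.ι ℂ k * p)) -
        FreeAlgebra.lift ℂ X (rightTraceDQ X Ω j (FreeAlgebra.ι ℂ k * p)) (kernelVec X Ω ξ j) =
        X k (contrR (kernelVec X Ω ξ j) (dqVec X Ω j p) -
          FreeAlgebra.lift ℂ X (rightTraceDQ X Ω j p) (kernelVec X Ω ξ j)) +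
        if k = j then ⟪kernelVec X Ω ξ j, polyVec X Ω p⟫_ℂ • Ω -
          ⟪Ω, polyVec X Ω p⟫_ℂ • kernelVec X Ω ξ j else 0 := by
      intro j
      rw [dqVec_ι_mul, rightTraceDQ_ι_mul, map_add, map_add, contrR_leftLeg, map_mul,
        FreeAlgebra.lift_ι_apply, add_apply, mul_apply_eq_comp, map_sub]
      split_ifs
      · rw [contrR_htmul, map_smul, map_one, smul_apply,
          one_apply_eq_self]
        abel
      · simp
    simp only [h, Finset.sum_add_distrib, ← map_sum, hp, Finset.sum_ite_eq, Finset.mem_univ,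
      if_true]
    rw [polyVec_ι_mul, commutator_kernelProj hX hL, map_neg]
    abel

/-- Leibniz writes (τ ⊗ 1)(a*·∂_j w) as (τ ⊗ 1)∂_j(a*w) minus ((τ ⊗ 1)∂_j a*)w, and both terms are
bounded in w. Contractions of a gradient against polynomials therefore depend continuously on the
vector alone; this carries identities from polynomials to ξ_i and gives closability of ∑ c_j ∂_j.
`contrR_polyVec_of_mem_closure_graph` is the mirror image. -/
theorem contrL_polyVec_of_mem_closure_graph {j : Fin n} {w : H × HTensor H}
    (hw : w ∈ (freeDQ X Ω j).closure.graph) (a : FreeAlgebra ℂ (Fin n)) :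
    contrL (polyVec X Ω a) w.2 =
      tomitaJ X Ω (annihilation X Ω ξ j
        (tomitaJ X Ω (FreeAlgebra.lift ℂ X (starPoly a) w.1))) -
      FreeAlgebra.lift ℂ X (starPoly (rightTraceDQ X Ω j a)) w.1 := by
  refine hX.closure_graph_induction (hL.closable j) (P := fun w =>
    contrL (polyVec X Ω a) w.2 =
      tomitaJ X Ω (annihilation X Ω ξ j
        (tomitaJ X Ω (FreeAlgebra.lift ℂ X (starPoly a) w.1))) -
      FreeAlgebra.lift ℂ X (starPoly (rightTraceDQ X Ω j a)) w.1)
    (isClosed_eq (by fun_prop) (by fun_prop)) (fun p => ?_) hw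
  simp only
  have h1 : contrL Ω (dqVec X Ω j (starPoly a)) =
      polyVec X Ω (starPoly (rightTraceDQ X Ω j a)) := by
    rw [← tomitaJ_annihilation_tomitaJ_polyVec hX hL, hX.tomitaJ_polyVec, starPoly_starPoly,
      annihilation_polyVec hX hL, ← polyVec_rightTraceDQ, hX.tomitaJ_polyVec]
  have h2 : ∀ z, contrL Ω (rightLeg (rmul X Ω (FreeAlgebra.lift ℂ X p)) z) =
      rmul X Ω (FreeAlgebra.lift ℂ X p) (contrL Ω z) := by
    intro z
    refine ext_inner_left ℂ fun y => ?_
    rw [inner_contrL, inner_htmul_rightLeg, ← inner_contrL, ContinuousLinearMap.star_eq_adjoint,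
      ContinuousLinearMap.adjoint_inner_left]
  have h3 : contrL Ω (leftLeg (FreeAlgebra.lift ℂ X (starPoly a)) (dqVec X Ω j p)) =
      contrL (polyVec X Ω a) (dqVec X Ω j p) := by
    refine ext_inner_left ℂ fun y => ?_
    rw [inner_contrL, inner_htmul_leftLeg, inner_contrL, lift_starPoly hX.selfAdjoint, star_star,
      polyVec_apply]
  rw [← polyVec_mul, ← polyVec_mul, tomitaJ_annihilation_tomitaJ_polyVec hX hL, hX.dqVec_mul,
    map_add, h2, h1, hX.rmul_polyVec, h3, add_sub_cancel_right]

theorem contrR_polyVec_of_mem_closure_graph {j : Fin n} {w : H × HTensor H}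
    (hw : w ∈ (freeDQ X Ω j).closure.graph) (b : FreeAlgebra ℂ (Fin n)) :
    contrR (polyVec X Ω (starPoly b)) w.2 =
      annihilation X Ω ξ j (rmul X Ω (FreeAlgebra.lift ℂ X b) w.1) -
      rmul X Ω (FreeAlgebra.lift ℂ X (rightTraceDQ X Ω j b)) w.1 := by
  refine hX.closure_graph_induction (hL.closable j) (P := fun w =>
    contrR (polyVec X Ω (starPoly b)) w.2 =
      annihilation X Ω ξ j (rmul X Ω (FreeAlgebra.lift ℂ X b) w.1) -
      rmul X Ω (FreeAlgebra.lift ℂ X (rightTraceDQ X Ω j b)) w.1)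
    (isClosed_eq (by fun_prop) (by fun_prop)) (fun p => ?_) hw
  simp only
  have h3 : contrR Ω (rightLeg (rmul X Ω (FreeAlgebra.lift ℂ X b)) (dqVec X Ω j p)) =
      contrR (polyVec X Ω (starPoly b)) (dqVec X Ω j p) := by
    refine ext_inner_left ℂ fun y => ?_
    rw [inner_contrR, inner_htmul_rightLeg, inner_contrR, hX.star_rmul,
      ← lift_starPoly hX.selfAdjoint, hX.rmul_Ω (lift_mem_wStar X _), polyVec_apply]
  rw [hX.rmul_polyVec, hX.rmul_polyVec, annihilation_polyVec hX hL, hX.dqVec_mul, map_add,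
    contrR_leftLeg, h3, ← polyVec_rightTraceDQ, polyVec_mul, add_sub_cancel_left]

end Kernel

/-! ### Triviality of the centered joint kernel -/

section KernelTrivial

variable {n : ℕ} {H : Type*} [NormedAddCommGroup H] [InnerProductSpace ℂ H] [CompleteSpace H]
  {X : Fin n → H →L[ℂ] H} {Ω : H} {ξ : Fin n → H}
  {Jac : Matrix (Fin n) (Fin n) (HTensor H →L[ℂ] HTensor H)}

/-- For a polynomial y = q, T(1 ⊗ q) = (1 ⊗ q)T(1 ⊗ 1), and 1 ⊗ q moves to the other side of the
inner product. Density covers arbitrary y, which is needed because W_j is only known to be in L²(M).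
-/
theorem IsTracialTuple.inner_tensorOp_htmul_left (hX : IsTracialTuple X Ω)
    {T : HTensor H →L[ℂ] HTensor H} (hT : T ∈ tensorOp X Ω) (b : FreeAlgebra ℂ (Fin n))
    (x y : H) :
    ⟪htmul x (polyVec X Ω b), T (htmul Ω y)⟫_ℂ =
      ⟪htmul x (rmul X Ω (FreeAlgebra.lift ℂ X b) (tomitaJ X Ω y)), T (htmul Ω Ω)⟫_ℂ := by
  simp only [← htmulL_apply]
  induction y using hX.denseRange_polyVec.induction_on with
  | hp => exact isClosed_eq (by fun_prop) (by fun_prop)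
  | ih q =>
    simp only [htmulL_apply]
    have h : T (htmul Ω (polyVec X Ω q)) =
        rightLeg (FreeAlgebra.lift ℂ X q) (T (htmul Ω Ω)) := by
      rw [polyVec_apply, ← rightLeg_htmul]
      exact (DFunLike.congr_fun (hX.commute_tensorOp_rightLeg hT (lift_mem_wStar X q)).eq
        (htmul Ω Ω)).symm
    rw [h, inner_htmul_rightLeg, hX.tomitaJ_polyVec, hX.rmul_polyVec, polyVec_mul,
      lift_starPoly hX.selfAdjoint]

theorem IsTracialTuple.inner_tensorOp_htmul_right (hX : IsTracialTuple X Ω)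
    {T : HTensor H →L[ℂ] HTensor H} (hT : T ∈ tensorOp X Ω) (a : FreeAlgebra ℂ (Fin n))
    (y z : H) :
    ⟪htmul (polyVec X Ω a) z, T (htmul y Ω)⟫_ℂ =
      ⟪htmul (FreeAlgebra.lift ℂ X a (tomitaJ X Ω y)) z, T (htmul Ω Ω)⟫_ℂ := by
  simp only [← htmulL_apply]
  induction y using hX.denseRange_polyVec.induction_on with
  | hp => exact isClosed_eq (by fun_prop) (by fun_prop)
  | ih q =>
    simp only [htmulL_apply]
    have h : T (htmul (polyVec X Ω q) Ω) =
        leftLeg (rmul X Ω (FreeAlgebra.lift ℂ X q)) (T (htmul Ω Ω)) := by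
      rw [polyVec_apply, ← hX.rmul_Ω (lift_mem_wStar X q), ← leftLeg_htmul]
      exact (DFunLike.congr_fun (hX.commute_tensorOp_leftLeg_rmul hT (lift_mem_wStar X q)).eq
        (htmul Ω Ω)).symm
    rw [h, inner_htmul_leftLeg, hX.star_rmul, ← lift_starPoly hX.selfAdjoint, hX.rmul_polyVec,
      polyVec_mul, hX.tomitaJ_polyVec]

theorem IsTracialTuple.inner_tomitaJ_polyVec_left (hX : IsTracialTuple X Ω)
    (w : H) (q : FreeAlgebra ℂ (Fin n)) :
    ⟪tomitaJ X Ω w, polyVec X Ω q⟫_ℂ = ⟪polyVec X Ω (starPoly q), w⟫_ℂ := by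
  rw [hX.inner_tomitaJ_left, hX.tomitaJ_polyVec]

theorem IsTracialTuple.inner_polyVec_starPoly_mul (hX : IsTracialTuple X Ω)
    (p q : FreeAlgebra ℂ (Fin n)) (w : H) :
    ⟪polyVec X Ω (starPoly q * p), w⟫_ℂ = ⟪polyVec X Ω p, FreeAlgebra.lift ℂ X q w⟫_ℂ := by
  rw [polyVec_mul, lift_starPoly hX.selfAdjoint, ContinuousLinearMap.star_eq_adjoint,
    ContinuousLinearMap.adjoint_inner_left]

variable (hX : IsTracialTuple X Ω) (hL : IsLipschitzConjugate X Ω ξ Jac)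
include hX hL

/-- For polynomial g this is `kernelProj_polyVec` paired with a. The contractions of ∂_j g are
spelled out as bounded operators in g, so that the identity survives closure and can be used at g =
ξ_i. -/
theorem sum_inner_contrL_sub (a : FreeAlgebra ℂ (Fin n)) (g : H) :
    ∑ j, (⟪kernelVec X Ω ξ j, tomitaJ X Ω (annihilation X Ω ξ j
        (tomitaJ X Ω (FreeAlgebra.lift ℂ X (starPoly a) g))) -
      FreeAlgebra.lift ℂ X (starPoly (rightTraceDQ X Ω j a)) g⟫_ℂ -
      ⟪FreeAlgebra.lift ℂ X a (tomitaJ X Ω (kernelVec X Ω ξ j)), annihilation X Ω ξ j g⟫_ℂ) =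
    - ⟪polyVec X Ω a, kernelProj X Ω ξ g⟫_ℂ := by
  induction g using hX.denseRange_polyVec.induction_on with
  | hp => exact isClosed_eq (by fun_prop) (by fun_prop)
  | ih p =>
    rw [← inner_neg_right, ← kernelProj_polyVec hX hL, inner_sum]
    refine Finset.sum_congr rfl fun j _ => ?_
    have hg : (polyVec X Ω p, dqVec X Ω j p) ∈ (freeDQ X Ω j).closure.graph :=
      LinearPMap.le_graph_of_le (LinearPMap.le_closure _)
        ((hX.mem_graph_freeDQ_iff j _).2 ⟨p, rfl⟩)
    have h1 := contrL_polyVec_of_mem_closure_graph hX hL hg a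
    simp only at h1
    rw [← h1, inner_contrL, annihilation_polyVec hX hL, ← polyVec_rightTraceDQ, inner_sub_right,
      inner_contrR]
    congr 1
    rw [← ContinuousLinearMap.adjoint_inner_right, ← ContinuousLinearMap.star_eq_adjoint,
      ← lift_starPoly hX.selfAdjoint, ← polyVec_mul, hX.inner_tomitaJ_polyVec_left, starPoly_mul,
      starPoly_starPoly, hX.inner_polyVec_starPoly_mul]

/-- The right-handed counterpart: (∂_j p)b = ∂_j(pb) - p ∂_j b, so `kernelProj_polyVec` is used for
pb, paired with Ω, and for b, paired with p*. The first contributes nothing because PΩ = 0. -/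
theorem sum_inner_contrR_sub (b : FreeAlgebra ℂ (Fin n)) (g : H) :
    ∑ j, (⟪rmul X Ω (FreeAlgebra.lift ℂ X (starPoly b)) (kernelVec X Ω ξ j),
        tomitaJ X Ω (annihilation X Ω ξ j (tomitaJ X Ω g))⟫_ℂ -
      ⟪tomitaJ X Ω (kernelVec X Ω ξ j),
        annihilation X Ω ξ j (rmul X Ω (FreeAlgebra.lift ℂ X b) g) -
          rmul X Ω (FreeAlgebra.lift ℂ X (rightTraceDQ X Ω j b)) g⟫_ℂ) =
    ⟪tomitaJ X Ω g, kernelProj X Ω ξ (polyVec X Ω b)⟫_ℂ := by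
  induction g using hX.denseRange_polyVec.induction_on with
  | hp => exact isClosed_eq (by fun_prop) (by fun_prop)
  | ih p =>
    have h0 : ⟪tomitaJ X Ω (polyVec X Ω p), kernelProj X Ω ξ (polyVec X Ω b)⟫_ℂ =
        ⟪Ω, - kernelProj X Ω ξ (polyVec X Ω (p * b))⟫_ℂ -
        ⟪polyVec X Ω (starPoly p), - kernelProj X Ω ξ (polyVec X Ω b)⟫_ℂ := by
      rw [inner_neg_right, ← inner_kernelProj Ω, kernelProj_Ω, inner_zero_left, neg_zero, zero_sub,
        inner_neg_right, neg_neg, hX.tomitaJ_polyVec]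
    rw [h0, ← kernelProj_polyVec hX hL, ← kernelProj_polyVec hX hL, inner_sum, inner_sum,
      ← Finset.sum_sub_distrib]
    refine Finset.sum_congr rfl fun j _ => ?_
    have h1 : ⟪rmul X Ω (FreeAlgebra.lift ℂ X (starPoly b)) (kernelVec X Ω ξ j),
        contrL Ω (dqVec X Ω j p)⟫_ℂ = ⟪Ω, contrR (kernelVec X Ω ξ j) (dqVec X Ω j (p * b))⟫_ℂ -
          ⟪polyVec X Ω (starPoly p), contrR (kernelVec X Ω ξ j) (dqVec X Ω j b)⟫_ℂ := by
      rw [inner_contrL, inner_contrR, inner_contrR, hX.dqVec_mul, inner_add_right,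
        inner_htmul_leftLeg, inner_htmul_rightLeg, hX.star_rmul, ← lift_starPoly hX.selfAdjoint,
        ← lift_starPoly hX.selfAdjoint, ← polyVec_apply, add_sub_cancel_left]
    have h2 : ⟪tomitaJ X Ω (kernelVec X Ω ξ j), polyVec X Ω (rightTraceDQ X Ω j (p * b))⟫_ℂ =
        ⟪Ω, FreeAlgebra.lift ℂ X (rightTraceDQ X Ω j (p * b)) (kernelVec X Ω ξ j)⟫_ℂ := by
      have := hX.inner_polyVec_starPoly_mul 1 (rightTraceDQ X Ω j (p * b)) (kernelVec X Ω ξ j)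
      rwa [mul_one, polyVec_one, ← hX.inner_tomitaJ_polyVec_left] at this
    have h3 : ⟪tomitaJ X Ω (kernelVec X Ω ξ j), polyVec X Ω (p * rightTraceDQ X Ω j b)⟫_ℂ =
        ⟪polyVec X Ω (starPoly p),
          FreeAlgebra.lift ℂ X (rightTraceDQ X Ω j b) (kernelVec X Ω ξ j)⟫_ℂ := by
      rw [hX.inner_tomitaJ_polyVec_left, starPoly_mul, hX.inner_polyVec_starPoly_mul]
    rw [tomitaJ_annihilation_tomitaJ_polyVec hX hL, h1, hX.rmul_polyVec, hX.rmul_polyVec,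
      annihilation_polyVec hX hL, ← polyVec_rightTraceDQ, inner_sub_right, h2, h3,
      inner_sub_right, inner_sub_right]
    ring

/-- At g = ξ_i the two terms of each summand in `sum_inner_contrL_sub` are the Jacobian entry acting
on the two halves of the kernel tensor. `sum_inner_htmul_left_kernelTensor` uses
`sum_inner_contrR_sub` and Jξ_i = ξ_i in the same way. -/
theorem sum_inner_htmul_right_kernelTensor (i : Fin n) (x : H) :
    ∑ j, ⟪htmul x Ω, Jac i j (kernelTensor X Ω ξ j)⟫_ℂ = - ⟪x, kernelProj X Ω ξ (ξ i)⟫_ℂ := by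
  simp only [← htmulL_apply]
  induction x using hX.denseRange_polyVec.induction_on with
  | hp =>
    refine isClosed_eq ?_ (by fun_prop)
    exact continuous_finsetSum _ fun j _ =>
      (((htmulL H).flip Ω).continuous.inner continuous_const)
  | ih a =>
    simp only [htmulL_apply]
    rw [← sum_inner_contrL_sub hX hL]
    refine Finset.sum_congr rfl fun j _ => ?_
    have h1 := contrL_polyVec_of_mem_closure_graph hX hL (hL.jacobian i j) a
    have h2 := annihilation_of_mem_closure_graph hX hL (hL.jacobian i j)
    have h3 := hX.inner_tensorOp_htmul_left (hL.jacobian_mem i j) 1 (polyVec X Ω a)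
      (tomitaJ X Ω (kernelVec X Ω ξ j))
    have h4 : rmul X Ω (FreeAlgebra.lift ℂ X 1)
        (tomitaJ X Ω (tomitaJ X Ω (kernelVec X Ω ξ j))) = kernelVec X Ω ξ j := by
      rw [rmul_apply, map_one, star_one, one_apply_eq_self, hX.tomitaJ_tomitaJ,
        hX.tomitaJ_tomitaJ]
    rw [h4, polyVec_one] at h3
    simp only at h1 h2
    rw [← h1, h2, kernelTensor, map_sub, inner_sub_right, h3,
      hX.inner_tensorOp_htmul_right (hL.jacobian_mem i j) a (kernelVec X Ω ξ j) Ω, inner_contrL,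
      inner_contrR]

theorem sum_inner_htmul_left_kernelTensor (i : Fin n) (y : H) :
    ∑ j, ⟪htmul Ω (tomitaJ X Ω y), Jac i j (kernelTensor X Ω ξ j)⟫_ℂ =
      ⟪ξ i, kernelProj X Ω ξ y⟫_ℂ := by
  simp only [← htmulL_apply]
  induction y using hX.denseRange_polyVec.induction_on with
  | hp =>
    refine isClosed_eq ?_ (by fun_prop)
    exact continuous_finsetSum _ fun j _ => (((htmulL H Ω).continuous.comp
      (tomitaJ X Ω).continuous).inner continuous_const)
  | ih b =>
    simp only [htmulL_apply]
    have h0 := sum_inner_contrR_sub hX hL b (ξ i)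
    rw [hX.tomitaJ_conjugate (hL.conjugate i)] at h0
    rw [← h0, hX.tomitaJ_polyVec]
    refine Finset.sum_congr rfl fun j _ => ?_
    have h1 := contrR_polyVec_of_mem_closure_graph hX hL (hL.jacobian i j) b
    have h2 := tomitaJ_annihilation_of_mem_closure_graph hX hL (hL.jacobian i j)
    have h3 := hX.inner_tensorOp_htmul_left (hL.jacobian_mem i j) (starPoly b) Ω
      (tomitaJ X Ω (kernelVec X Ω ξ j))
    have h4 := hX.inner_tensorOp_htmul_right (hL.jacobian_mem i j) 1 (kernelVec X Ω ξ j)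
      (polyVec X Ω (starPoly b))
    rw [hX.tomitaJ_tomitaJ] at h3
    rw [polyVec_one, map_one, one_apply_eq_self] at h4
    simp only at h1 h2
    rw [hX.tomitaJ_conjugate (hL.conjugate i)] at h2
    rw [← h1, h2, kernelTensor, map_sub, inner_sub_right, h3, h4, inner_contrL, inner_contrR]

theorem inner_conjugate_kernelVec (i : Fin n) : ⟪ξ i, kernelVec X Ω ξ i⟫_ℂ = 0 := by
  have h := ContinuousLinearMap.adjoint_inner_right (creation X Ω ξ i) Ω (kernelVec X Ω ξ i)
  rw [creation_Ω hX hL] at h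
  rw [← h]
  change ⟪Ω, annihilation X Ω ξ i _⟫_ℂ = 0
  rw [(mem_centeredKernel.1 (kernelVec_mem i)).2, inner_zero_right]

/-- CD(1,∞) is tested on the kernel tensors: pairing with either half of the i-th tensor gives, up
to sign and conjugation, ⟨ξ_i, W_i⟩ = 0, so the tensors have norm zero. -/
theorem kernelVec_eq_zero (hCD : CurvatureDimension 1 Jac) (i : Fin n) :
    kernelVec X Ω ξ i = 0 := by
  have h := hCD (kernelTensor X Ω ξ)
  have h0 : ∀ i, ∑ j, ⟪kernelTensor X Ω ξ i, Jac i j (kernelTensor X Ω ξ j)⟫_ℂ = 0 := by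
    intro i
    have h1 := sum_inner_htmul_right_kernelTensor hX hL i (kernelVec X Ω ξ i)
    have h2 := sum_inner_htmul_left_kernelTensor hX hL i (kernelVec X Ω ξ i)
    rw [← inner_kernelProj, kernelProj_of_mem (kernelVec_mem i), ← inner_conj_symm,
      inner_conjugate_kernelVec hX hL, map_zero, neg_zero] at h1
    rw [kernelProj_of_mem (kernelVec_mem i), inner_conjugate_kernelVec hX hL] at h2
    conv_lhs =>
      enter [2, j]
      rw [kernelTensor, inner_sub_left]
    rw [Finset.sum_sub_distrib, h1, h2, sub_zero]
  rw [Finset.sum_congr rfl fun i _ => h0 i, Finset.sum_const_zero, one_mul] at h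
  have h1 : ∑ i, ‖kernelTensor X Ω ξ i‖ ^ 2 ≤ 0 := by
    have := (Complex.le_def.1 h).1
    rwa [Complex.ofReal_re, Complex.zero_re] at this
  have h2 : ∑ i, ‖kernelTensor X Ω ξ i‖ ^ 2 = 0 := le_antisymm h1 (by positivity)
  have h3 := (Finset.sum_eq_zero_iff_of_nonneg fun i _ => sq_nonneg ‖kernelTensor X Ω ξ i‖).1 h2 i
    (Finset.mem_univ i)
  have h4 : kernelTensor X Ω ξ i = 0 := norm_eq_zero.1 (pow_eq_zero_iff two_ne_zero |>.1 h3)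
  -- Since JW_i is centered, contracting the right leg with Ω leaves only -W_i.
  have h5 := congrArg (contrR Ω) h4
  have h6 : ⟪Ω, tomitaJ X Ω (kernelVec X Ω ξ i)⟫_ℂ = 0 := by
    rw [hX.inner_tomitaJ, hX.tomitaJ_Ω, ← inner_conj_symm,
      (mem_centeredKernel.1 (kernelVec_mem i)).1, map_zero]
  rw [kernelTensor, map_sub, contrR_htmul, contrR_htmul, hX.inner_self, h6, map_zero, zero_smul,
    one_smul, zero_sub, neg_eq_zero] at h5
  exact h5

/-- Under the curvature condition, a centered vector killed by all annihilation operators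
vanishes. -/
theorem eq_zero_of_mem_centeredKernel (hCD : CurvatureDimension 1 Jac) {v : H}
    (hv : v ∈ centeredKernel X Ω ξ) : v = 0 := by
  have h : ∀ p, kernelProj X Ω ξ (polyVec X Ω p) = 0 := by
    intro p
    induction p using freeAlgebra_induction_left with
    | h1 => rw [polyVec_one, kernelProj_Ω]
    | hadd p q hp hq => rw [map_add, map_add, hp, hq, add_zero]
    | hsmul c p hp => rw [map_smul, map_smul, hp, smul_zero]
    | hmul k p hp =>
      rw [polyVec_ι_mul, commutator_kernelProj hX hL, hp, kernelVec_eq_zero hX hL hCD]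
      simp
  have h2 : ∀ v, kernelProj X Ω ξ v = 0 := by
    intro v
    induction v using hX.denseRange_polyVec.induction_on with
    | hp => exact isClosed_eq (by fun_prop) (by fun_prop)
    | ih p => exact h p
  rw [← kernelProj_of_mem hv, h2]

end KernelTrivial

/-! ### The sharp Poincaré inequality and its extremals -/

section Poincare

variable {n : ℕ} {H : Type*} [NormedAddCommGroup H] [InnerProductSpace ℂ H] [CompleteSpace H]
  {X : Fin n → H →L[ℂ] H} {Ω : H} {ξ : Fin n → H}
  {Jac : Matrix (Fin n) (Fin n) (HTensor H →L[ℂ] HTensor H)}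

theorem inner_creation (j : Fin n) (u v : H) :
    ⟪creation X Ω ξ j u, v⟫_ℂ = ⟪u, annihilation X Ω ξ j v⟫_ℂ :=
  (ContinuousLinearMap.adjoint_inner_right _ _ _).symm

/-- Cauchy–Schwarz gives the bound without the extra 1, which makes the constant strictly positive
so that it can be divided out in `norm_sq_le_sum_annihilation`. -/
theorem norm_sum_creation_sq_le (η : Fin n → H) :
    ‖∑ j, creation X Ω ξ j (η j)‖ ^ 2 ≤
      (∑ j, ‖creation X Ω ξ j‖ ^ 2 + 1) * ∑ j, ‖η j‖ ^ 2 := by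
  have h1 : ‖∑ j, creation X Ω ξ j (η j)‖ ≤ ∑ j, ‖creation X Ω ξ j‖ * ‖η j‖ :=
    (norm_sum_le _ _).trans (Finset.sum_le_sum fun j _ => ContinuousLinearMap.le_opNorm _ _)
  have h2 := Finset.sum_mul_sq_le_sq_mul_sq Finset.univ (fun j => ‖creation X Ω ξ j‖)
    (fun j => ‖η j‖)
  have h3 : 0 ≤ ∑ j, ‖η j‖ ^ 2 := by positivity
  have h4 := pow_le_pow_left₀ (norm_nonneg _) h1 2
  linarith

variable (hX : IsTracialTuple X Ω) (hL : IsLipschitzConjugate X Ω ξ Jac)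
  (hCD : CurvatureDimension 1 Jac)
include hX hL hCD

/-- A vector orthogonal to the range is killed by all T_j; subtracting its Ω-component gives an
element of the trivial centered kernel, so it is a multiple of Ω and orthogonal to f. -/
theorem mem_closure_range_creation {f : H} (hf : ⟪Ω, f⟫_ℂ = 0) :
    f ∈ closure (Set.range fun η : Fin n → H => ∑ j, creation X Ω ξ j (η j)) := by
  let R : (Fin n → H) →ₗ[ℂ] H :=
    ∑ j, (creation X Ω ξ j).toLinearMap ∘ₗ LinearMap.proj j
  have hR : ∀ η, R η = ∑ j, creation X Ω ξ j (η j) := fun η => by simp [R]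
  have h : f ∈ (LinearMap.range R).topologicalClosure := by
    rw [← Submodule.orthogonal_orthogonal_eq_closure, Submodule.mem_orthogonal]
    intro v hv
    have hann : ∀ j, annihilation X Ω ξ j v = 0 := by
      intro j
      refine ext_inner_left ℂ fun u => ?_
      have := (Submodule.mem_orthogonal _ _).1 hv _ ⟨Pi.single j u, rfl⟩
      rw [hR, Finset.sum_eq_single j] at this
      · rwa [Pi.single_eq_same, inner_creation, ← inner_zero_right u] at this
      · intro k _ hk
        rw [Pi.single_eq_of_ne hk, map_zero]
      · simp
    have hmem : v - ⟪Ω, v⟫_ℂ • Ω ∈ centeredKernel X Ω ξ := by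
      rw [mem_centeredKernel]
      refine ⟨?_, fun j => ?_⟩
      · rw [inner_sub_right, inner_smul_right, hX.inner_self, mul_one, sub_self]
      · rw [map_sub, map_smul, hann, annihilation_Ω hX hL, smul_zero, sub_zero]
    rw [sub_eq_zero.1 (eq_zero_of_mem_centeredKernel hX hL hCD hmem), inner_smul_left, hf,
      mul_zero]
  have hs : ((LinearMap.range R : Submodule ℂ H) : Set H) =
      Set.range fun η : Fin n → H => ∑ j, creation X Ω ξ j (η j) := by
    rw [LinearMap.coe_range]
    exact congrArg Set.range (funext hR)
  rw [← hs]
  exact h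

/-- The Poincaré inequality for the annihilation operators, with a remainder term. -/
theorem norm_sub_sum_creation_sq_le {f : H} (hf : ⟪Ω, f⟫_ℂ = 0) :
    ‖f - ∑ j, creation X Ω ξ j (annihilation X Ω ξ j f)‖ ^ 2 ≤
      (∑ j, ‖creation X Ω ξ j‖ ^ 2 + 1) *
        (∑ j, ‖annihilation X Ω ξ j f‖ ^ 2 - ‖f‖ ^ 2) := by
  -- For h = Aη the left side is ‖A(η - Tf)‖². Expanding ‖η - Tf‖² and using ‖η‖ ≤ ‖h‖ eliminates η,
  -- and the resulting inequality is closed in h, hence valid at h = f.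
  have key : ∀ h ∈ closure (Set.range fun η : Fin n → H => ∑ j, creation X Ω ξ j (η j)),
      ‖h - ∑ j, creation X Ω ξ j (annihilation X Ω ξ j f)‖ ^ 2 ≤
      (∑ j, ‖creation X Ω ξ j‖ ^ 2 + 1) *
        (‖h‖ ^ 2 - 2 * RCLike.re ⟪h, f⟫_ℂ + ∑ j, ‖annihilation X Ω ξ j f‖ ^ 2) := by
    have hcl : IsClosed {h : H | ‖h - ∑ j, creation X Ω ξ j (annihilation X Ω ξ j f)‖ ^ 2 ≤
      (∑ j, ‖creation X Ω ξ j‖ ^ 2 + 1) *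
        (‖h‖ ^ 2 - 2 * RCLike.re ⟪h, f⟫_ℂ + ∑ j, ‖annihilation X Ω ξ j f‖ ^ 2)} :=
      isClosed_le (by fun_prop) (by fun_prop)
    intro h hh
    refine hcl.closure_subset_iff.2 ?_ hh
    rintro _ ⟨η, rfl⟩
    simp only [Set.mem_ofPred_eq]
    rw [← Finset.sum_sub_distrib]
    simp_rw [← map_sub]
    refine (norm_sum_creation_sq_le _).trans ?_
    gcongr
    have h1 := sum_norm_sq_le_norm_sum_creation hX hL hCD η
    have h2 : RCLike.re ⟪∑ j, creation X Ω ξ j (η j), f⟫_ℂ =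
        ∑ j, RCLike.re ⟪η j, annihilation X Ω ξ j f⟫_ℂ := by
      rw [sum_inner, map_sum]
      simp_rw [inner_creation]
    have h3 : ∑ j, ‖η j - annihilation X Ω ξ j f‖ ^ 2 =
        ∑ j, ‖η j‖ ^ 2 - 2 * ∑ j, RCLike.re ⟪η j, annihilation X Ω ξ j f⟫_ℂ +
          ∑ j, ‖annihilation X Ω ξ j f‖ ^ 2 := by
      rw [Finset.mul_sum, ← Finset.sum_sub_distrib, ← Finset.sum_add_distrib]
      exact Finset.sum_congr rfl fun j _ => @norm_sub_sq ℂ _ _ _ _ _ _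
    rw [h3, h2]
    linarith
  refine (key f (mem_closure_range_creation hX hL hCD hf)).trans_eq ?_
  rw [inner_self_eq_norm_sq]
  ring

theorem norm_sq_le_sum_annihilation {f : H} (hf : ⟪Ω, f⟫_ℂ = 0) :
    ‖f‖ ^ 2 ≤ ∑ j, ‖annihilation X Ω ξ j f‖ ^ 2 := by
  have h := (sq_nonneg _).trans (norm_sub_sum_creation_sq_le hX hL hCD hf)
  have hC : 0 < ∑ j, ‖creation X Ω ξ j‖ ^ 2 + 1 := by positivity
  exact sub_nonneg.1 (nonneg_of_mul_nonneg_right h hC)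

theorem eq_sum_creation_of_norm_sq_eq {f : H} (hf : ⟪Ω, f⟫_ℂ = 0)
    (hsat : ‖f‖ ^ 2 = ∑ j, ‖annihilation X Ω ξ j f‖ ^ 2) :
    f = ∑ j, creation X Ω ξ j (annihilation X Ω ξ j f) := by
  have h := norm_sub_sum_creation_sq_le hX hL hCD hf
  rw [← hsat, sub_self, mul_zero] at h
  exact sub_eq_zero.1 (norm_eq_zero.1 (pow_eq_zero_iff two_ne_zero |>.1
    (le_antisymm h (sq_nonneg _))))

/-- A self-adjoint centered vector that saturates the Poincaré inequality has constant real
gradient, and it is the corresponding combination of the generators and of the conjugate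
variables. -/
theorem exists_coefficients_of_saturated {f : H} {v : Fin n → HTensor H}
    (hv : ∀ j, (f, v j) ∈ (freeDQ X Ω j).closure.graph) (hf : ⟪Ω, f⟫_ℂ = 0)
    (hsat : ‖f‖ ^ 2 = ∑ j, ‖v j‖ ^ 2) (hJ : tomitaJ X Ω f = f) :
    ∃ c : Fin n → ℝ, (∀ j, v j = (c j : ℂ) • htmul Ω Ω) ∧
      f = ∑ j, (c j : ℂ) • centeredGen X Ω j Ω ∧ f = ∑ j, (c j : ℂ) • ξ j ∧
      ∑ j, c j ^ 2 = ‖f‖ ^ 2 := by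
  have hT : ∀ j, annihilation X Ω ξ j f = contrR Ω (v j) := fun j =>
    annihilation_of_mem_closure_graph hX hL (hv j)
  have hle : ∀ j, ‖annihilation X Ω ξ j f‖ ^ 2 ≤ ‖v j‖ ^ 2 := by
    intro j
    rw [hT]
    have := norm_contrR_le Ω (v j)
    rw [hX.norm_one, one_mul] at this
    gcongr
  have hP := norm_sq_le_sum_annihilation hX hL hCD hf
  have hsum : ∑ j, ‖annihilation X Ω ξ j f‖ ^ 2 = ∑ j, ‖v j‖ ^ 2 :=
    le_antisymm (Finset.sum_le_sum fun j _ => hle j) (hsat ▸ hP)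
  have heq : ∀ j, ‖annihilation X Ω ξ j f‖ ^ 2 = ‖v j‖ ^ 2 := fun j =>
    (Finset.sum_eq_sum_iff_of_le fun j _ => hle j).1 hsum j (Finset.mem_univ j)
  have hv1 : ∀ j, v j = htmul (annihilation X Ω ξ j f) Ω := by
    intro j
    have h := (sq_eq_sq₀ (norm_nonneg _) (norm_nonneg _)).1 (heq j)
    rw [hT] at h ⊢
    exact eq_htmul_of_norm_le_contrR hX.norm_one h.ge
  -- Contracting the left leg of ∂̄_j f = T_j f ⊗ 1 with Ω gives a scalar, while f = Jf identifies
  -- the same contraction with J T_j f.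
  have hJT : ∀ j, tomitaJ X Ω (annihilation X Ω ξ j f) =
      ⟪Ω, annihilation X Ω ξ j f⟫_ℂ • Ω := by
    intro j
    have h := tomitaJ_annihilation_of_mem_closure_graph hX hL (hv j)
    simp only [hJ] at h
    rw [h, hv1, contrL_htmul]
  have hT2 : ∀ j, annihilation X Ω ξ j f =
      (starRingEnd ℂ ⟪Ω, annihilation X Ω ξ j f⟫_ℂ) • Ω := by
    intro j
    have h := congrArg (tomitaJ X Ω) (hJT j)
    rwa [hX.tomitaJ_tomitaJ, map_smulₛₗ, hX.tomitaJ_Ω] at h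
  have hreal : ∀ j, starRingEnd ℂ ⟪Ω, annihilation X Ω ξ j f⟫_ℂ =
      ⟪Ω, annihilation X Ω ξ j f⟫_ℂ := by
    intro j
    have h := congrArg (fun u => ⟪Ω, u⟫_ℂ) (hT2 j)
    simp only [inner_smul_right, hX.inner_self, mul_one] at h
    exact h.symm
  have hT3 : ∀ j, annihilation X Ω ξ j f = ((⟪Ω, annihilation X Ω ξ j f⟫_ℂ).re : ℂ) • Ω := by
    intro j
    rw [Complex.conj_eq_iff_re.1 (hreal j), ← hreal]
    exact hT2 j
  generalize hc : (fun j => (⟪Ω, annihilation X Ω ξ j f⟫_ℂ).re) = c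
  have hT4 : ∀ j, annihilation X Ω ξ j f = (c j : ℂ) • Ω := by
    intro j
    rw [← hc]
    exact hT3 j
  have hTX : ∀ j k, annihilation X Ω ξ j (centeredGen X Ω k Ω) = if k = j then Ω else 0 := by
    intro j k
    rw [centeredGen, sub_apply, smul_apply, one_apply_eq_self, map_sub, map_smul,
      annihilation_Ω hX hL, annihilation_generator_apply hX hL, annihilation_Ω hX hL,
      hX.inner_self]
    simp
  refine ⟨c, fun j => ?_, ?_, ?_, ?_⟩
  · rw [hv1, hT4, smul_htmul]
  · have hmem : f - ∑ j, (c j : ℂ) • centeredGen X Ω j Ω ∈ centeredKernel X Ω ξ := by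
      rw [mem_centeredKernel]
      constructor
      · rw [inner_sub_right, hf, inner_sum, zero_sub, neg_eq_zero]
        refine Finset.sum_eq_zero fun j _ => ?_
        rw [centeredGen, sub_apply, smul_apply, one_apply_eq_self, inner_smul_right,
          inner_sub_right, inner_smul_right, hX.inner_self, trace, mul_one, sub_self, mul_zero]
      · intro j
        rw [map_sub, map_sum, hT4]
        simp [hTX]
    exact sub_eq_zero.1 (eq_zero_of_mem_centeredKernel hX hL hCD hmem)
  · have h := eq_sum_creation_of_norm_sq_eq hX hL hCD hf (hsat.trans hsum.symm)
    simp_rw [hT4, map_smul, creation_Ω hX hL] at h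
    exact h
  · rw [hsat, ← hsum]
    refine Finset.sum_congr rfl fun j _ => ?_
    rw [hT4, norm_smul, hX.norm_one, mul_one, Complex.norm_real, Real.norm_eq_abs, sq_abs]

end Poincare

/-! ### Moments of the semicircle law -/

section Semicircle

theorem sum_range_two_mul_add_one {g : ℕ → ℂ} (hg : ∀ a, g (2 * a + 1) = 0) (k : ℕ) :
    ∑ i ∈ Finset.range (2 * k + 1), g i = ∑ a ∈ Finset.range (k + 1), g (2 * a) := by
  induction k with
  | zero => simp
  | succ k ih =>
    rw [Finset.sum_range_succ _ (k + 1), ← ih, show 2 * (k + 1) + 1 = 2 * k + 1 + 1 + 1 by ring,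
      Finset.sum_range_succ, Finset.sum_range_succ, hg, add_zero]
    rfl

/-- The moment recursion of the semicircle law determines the moments as Catalan numbers. -/
theorem moments_eq_catalan {t : ℕ → ℂ} (h0 : t 0 = 1) (h1 : t 1 = 0)
    (hrec : ∀ m, 1 ≤ m → t (m + 1) = ∑ k ∈ Finset.range m, t k * t (m - 1 - k)) (k : ℕ) :
    t (2 * k) = catalan k ∧ t (2 * k + 1) = 0 := by
  induction k using Nat.strong_induction_on with
  | _ k ih =>
    have hodd : ∀ a, a < k → t (2 * a + 1) = 0 := fun a ha => (ih a ha).2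
    rcases k with _ | k
    · simp [h0, h1]
    have heven : t (2 * (k + 1)) = catalan (k + 1) := by
      rw [show 2 * (k + 1) = (2 * k + 1) + 1 by ring, hrec _ (by omega)]
      -- Odd moments of lower order vanish by induction, so only even indices survive and form the
      -- Catalan convolution.
      have hz : ∀ i ∈ Finset.range (2 * k + 1), t i * t (2 * k + 1 - 1 - i) =
          if Even i then t i * t (2 * k - i) else 0 := by
        intro i hi
        rw [Finset.mem_range] at hi
        split_ifs with he
        · rfl
        · obtain ⟨a, rfl⟩ := Nat.not_even_iff_odd.1 he
          rw [hodd a (by omega), zero_mul]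
      rw [Finset.sum_congr rfl hz, sum_range_two_mul_add_one (by intro a; simp), catalan_succ]
      push_cast
      rw [Finset.sum_range]
      refine Finset.sum_congr rfl fun a _ => ?_
      have ha := a.2
      rw [if_pos (even_two_mul _), ← Nat.mul_sub, (ih a (by omega)).1, (ih (k - a) (by omega)).1]
    refine ⟨heven, ?_⟩
    rw [hrec _ (by omega)]
    refine Finset.sum_eq_zero fun i hi => ?_
    rw [Finset.mem_range] at hi
    -- The two indices add up to the odd number 2k + 1, so one of them is odd.
    rcases Nat.even_or_odd' i with ⟨a, rfl | rfl⟩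
    · rw [show 2 * (k + 1) - 1 - 2 * a = 2 * (k - a) + 1 by omega, hodd (k - a) (by omega),
        mul_zero]
    · rw [hodd a (by omega), zero_mul]

/-! ### Integrals against the semicircle density -/

theorem integral_semicircleLaw (m : ℕ) :
    ∫ x : ℝ, x ^ m ∂semicircleLaw =
      (∫ x in (-2 : ℝ)..2, x ^ m * √(4 - x ^ 2)) / (2 * Real.pi) := by
  rw [semicircleLaw, integral_withDensity_eq_integral_toReal_smul (by fun_prop) (by simp)]
  have h : ∀ x : ℝ, (ENNReal.ofReal (√(4 - x ^ 2) / (2 * Real.pi))).toReal • x ^ m =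
      (x ^ m * √(4 - x ^ 2)) / (2 * Real.pi) := by
    intro x
    rw [ENNReal.toReal_ofReal (by positivity), smul_eq_mul]
    ring
  simp_rw [h]
  rw [MeasureTheory.integral_div]
  congr 1
  rw [intervalIntegral.integral_of_le (by norm_num)]
  symm
  apply MeasureTheory.setIntegral_eq_integral_of_forall_compl_eq_zero
  intro x hx
  have : 4 - x ^ 2 ≤ 0 := by
    by_contra hlt
    push Not at hlt
    apply hx
    constructor <;> nlinarith
  rw [Real.sqrt_eq_zero_of_nonpos this, mul_zero]

theorem integral_pow_mul_sqrt_odd (k : ℕ) :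
    ∫ x in (-2 : ℝ)..2, x ^ (2 * k + 1) * √(4 - x ^ 2) = 0 := by
  have h := intervalIntegral.integral_comp_neg (a := (-2 : ℝ)) (b := 2)
    (fun x : ℝ => x ^ (2 * k + 1) * √(4 - x ^ 2))
  have h2 : ∀ x : ℝ, (-x) ^ (2 * k + 1) * √(4 - (-x) ^ 2) = -(x ^ (2 * k + 1) * √(4 - x ^ 2)) := by
    intro x
    rw [Odd.neg_pow ⟨k, rfl⟩, neg_sq]
    ring
  simp only [h2, neg_neg] at h
  rw [intervalIntegral.integral_neg] at h
  linarith

theorem integral_sqrt_four_sub_sq : ∫ x in (-2 : ℝ)..2, √(4 - x ^ 2) = 2 * Real.pi := by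
  have h := intervalIntegral.mul_integral_comp_mul_left (a := (-1 : ℝ)) (b := 1)
    (f := fun x : ℝ => √(4 - x ^ 2)) 2
  have h2 : ∀ x : ℝ, √(4 - (2 * x) ^ 2) = 2 * √(1 - x ^ 2) := by
    intro x
    rw [show 4 - (2 * x) ^ 2 = 2 ^ 2 * (1 - x ^ 2) by ring, Real.sqrt_mul (by norm_num),
      Real.sqrt_sq (by norm_num)]
  simp only [h2] at h
  rw [intervalIntegral.integral_const_mul, integral_sqrt_one_sub_sq] at h
  norm_num at h
  rw [← h]
  ring

/-- Integrate the derivative of x^(m+1) (4 - x²)^(3/2), which vanishes at both endpoints. -/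
theorem integral_pow_mul_sqrt_add_two (m : ℕ) :
    (m + 4) * ∫ x in (-2 : ℝ)..2, x ^ (m + 2) * √(4 - x ^ 2) =
      4 * (m + 1) * ∫ x in (-2 : ℝ)..2, x ^ m * √(4 - x ^ 2) := by
  have hderiv : ∀ x ∈ Set.Ioo (-2 : ℝ) 2,
      HasDerivAt (fun x : ℝ => x ^ (m + 1) * ((4 - x ^ 2) * √(4 - x ^ 2)))
        (4 * (m + 1) * (x ^ m * √(4 - x ^ 2)) - (m + 4) * (x ^ (m + 2) * √(4 - x ^ 2))) x := by
    intro x hx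
    have hpos : 0 < 4 - x ^ 2 := by nlinarith [hx.1, hx.2]
    have h1 : HasDerivAt (fun x : ℝ => 4 - x ^ 2) (-(2 * x)) x := by
      simpa using (hasDerivAt_pow 2 x).const_sub 4
    have h2 := h1.sqrt hpos.ne'
    have h3 := (hasDerivAt_pow (m + 1) x).mul (h1.mul h2)
    refine h3.congr_deriv ?_
    have hs : √(4 - x ^ 2) ^ 2 = 4 - x ^ 2 := Real.sq_sqrt hpos.le
    have hs0 : √(4 - x ^ 2) ≠ 0 := (Real.sqrt_pos.2 hpos).ne'
    have h5 : (4 - x ^ 2) * (-(2 * x) / (2 * √(4 - x ^ 2))) = - x * √(4 - x ^ 2) := by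
      rw [mul_div_assoc', div_eq_iff (by positivity)]
      linear_combination (2 * x) * hs
    simp only [Pi.mul_apply, Nat.add_sub_cancel, h5]
    push_cast
    ring
  have hI : ∀ k : ℕ, IntervalIntegrable (fun x : ℝ => x ^ k * √(4 - x ^ 2))
      MeasureTheory.volume (-2) 2 := fun k => by
    apply Continuous.intervalIntegrable
    fun_prop
  have h := intervalIntegral.integral_eq_sub_of_hasDerivAt_of_le (by norm_num)
    (by fun_prop) hderiv
    (((hI m).const_mul _).sub ((hI (m + 2)).const_mul _))
  rw [intervalIntegral.integral_sub ((hI m).const_mul _) ((hI (m + 2)).const_mul _),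
    intervalIntegral.integral_const_mul, intervalIntegral.integral_const_mul] at h
  norm_num at h
  linarith

theorem integral_pow_mul_sqrt_even (k : ℕ) :
    ∫ x in (-2 : ℝ)..2, x ^ (2 * k) * √(4 - x ^ 2) = 2 * Real.pi * catalan k := by
  induction k with
  | zero => simp [integral_sqrt_four_sub_sq]
  | succ k ih =>
    have h := integral_pow_mul_sqrt_add_two (2 * k)
    rw [ih] at h
    have hc : (k + 2 : ℝ) * catalan (k + 1) = 2 * (2 * k + 1) * catalan k := by
      have h1 := succ_mul_catalan_eq_centralBinom k
      have h2 := succ_mul_catalan_eq_centralBinom (k + 1)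
      have h3 := Nat.succ_mul_centralBinom_succ k
      rw [← h1, ← h2] at h3
      have h4 : (k + 1 : ℝ) * ((k + 2) * catalan (k + 1)) =
          (k + 1) * (2 * (2 * k + 1) * catalan k) := by
        have : ((k + 1) * ((k + 1 + 1) * catalan (k + 1)) : ℝ) =
          2 * (2 * k + 1) * ((k + 1) * catalan k) := by exact_mod_cast h3
        linear_combination this
      exact mul_left_cancel₀ (by positivity) h4
    push_cast at h
    rw [show 2 * (k + 1) = 2 * k + 2 by ring]
    have h5 : (2 * k + 4 : ℝ) ≠ 0 := by positivity
    apply mul_left_cancel₀ h5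
    rw [h]
    linear_combination (-4 * Real.pi) * hc

theorem integral_semicircleLaw_even (k : ℕ) :
    ∫ x : ℝ, x ^ (2 * k) ∂semicircleLaw = catalan k := by
  rw [integral_semicircleLaw, integral_pow_mul_sqrt_even]
  field_simp

theorem integral_semicircleLaw_odd (k : ℕ) :
    ∫ x : ℝ, x ^ (2 * k + 1) ∂semicircleLaw = 0 := by
  rw [integral_semicircleLaw, integral_pow_mul_sqrt_odd, zero_div]

/-- A sequence that satisfies the moment recursion is the moment sequence of the semicircle
law. -/
theorem moments_eq_integral_semicircleLaw {t : ℕ → ℂ} (h0 : t 0 = 1) (h1 : t 1 = 0)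
    (hrec : ∀ m, 1 ≤ m → t (m + 1) = ∑ k ∈ Finset.range m, t k * t (m - 1 - k)) (m : ℕ) :
    t m = ((∫ x : ℝ, x ^ m ∂semicircleLaw : ℝ) : ℂ) := by
  rcases Nat.even_or_odd' m with ⟨k, rfl | rfl⟩
  · rw [(moments_eq_catalan h0 h1 hrec k).1, integral_semicircleLaw_even]
    simp
  · rw [(moments_eq_catalan h0 h1 hrec k).2, integral_semicircleLaw_odd]
    simp

end Semicircle

/-! ### Linear combinations of the difference quotients -/

section Combination

variable {n : ℕ} {H : Type*} [NormedAddCommGroup H] [InnerProductSpace ℂ H]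
  {X : Fin n → H →L[ℂ] H} {Ω : H} {ξ : Fin n → H}
  {Jac : Matrix (Fin n) (Fin n) (HTensor H →L[ℂ] HTensor H)}

/-- The values of `∑ⱼ cⱼ ∂ⱼ` on polynomials. -/
def combDQVec (X : Fin n → H →L[ℂ] H) (Ω : H) (c : Fin n → ℝ) :
    FreeAlgebra ℂ (Fin n) →ₗ[ℂ] HTensor H :=
  ∑ j, (c j : ℂ) • dqVec X Ω j

theorem combDQVec_apply (c : Fin n → ℝ) (p : FreeAlgebra ℂ (Fin n)) :
    combDQVec X Ω c p = ∑ j, (c j : ℂ) • dqVec X Ω j p := by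
  simp [combDQVec]

/-- The polynomial `∑ⱼ cⱼ (tⱼ - τ(Xⱼ))`. -/
def linearPoly (X : Fin n → H →L[ℂ] H) (Ω : H) (c : Fin n → ℝ) : FreeAlgebra ℂ (Fin n) :=
  ∑ j, (c j : ℂ) • (FreeAlgebra.ι ℂ j - trace Ω (X j) • 1)

theorem lift_linearPoly (c : Fin n → ℝ) :
    FreeAlgebra.lift ℂ X (linearPoly X Ω c) = ∑ j, (c j : ℂ) • centeredGen X Ω j := by
  simp only [linearPoly, centeredGen, map_sum, map_smul, map_sub, FreeAlgebra.lift_ι_apply, map_one]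

theorem combDQVec_linearPoly {c : Fin n → ℝ} (hc : ∑ j, c j ^ 2 = 1) :
    combDQVec X Ω c (linearPoly X Ω c) = htmul Ω Ω := by
  have h : ∀ j, dqVec X Ω j (linearPoly X Ω c) = (c j : ℂ) • htmul Ω Ω := by
    intro j
    simp only [linearPoly, map_sum, map_smul, map_sub, dqVec_ι, dqVec_one, smul_zero, sub_zero,
      smul_ite, Finset.sum_ite_eq', Finset.mem_univ, if_true]
  rw [combDQVec_apply]
  simp_rw [h, smul_smul, ← Finset.sum_smul]
  have h1 : ∑ j, (c j : ℂ) * (c j : ℂ) = 1 := by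
    rw [← Complex.ofReal_one, ← hc]
    push_cast
    exact Finset.sum_congr rfl fun j _ => by ring
  rw [h1, one_smul]

variable [CompleteSpace H]

namespace IsTracialTuple

variable (hX : IsTracialTuple X Ω)
include hX

/-- The domain bound needs a nonempty sum: the empty one is the zero operator with full domain. This
is the source of the later `NeZero n`. -/
theorem sum_smul_freeDQ (c : Fin n → ℂ) (s : Finset (Fin n)) :
    (∀ p, polyVec X Ω p ∈ (∑ j ∈ s, c j • freeDQ X Ω j).domain) ∧
    (∀ p h, (∑ j ∈ s, c j • freeDQ X Ω j) ⟨polyVec X Ω p, h⟩ =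
      ∑ j ∈ s, c j • dqVec X Ω j p) ∧
    (s.Nonempty → (∑ j ∈ s, c j • freeDQ X Ω j).domain ≤ LinearMap.range (polyVec X Ω)) := by
  induction s using Finset.induction_on with
  | empty =>
    refine ⟨fun p => ?_, fun p h => ?_, by simp⟩
    · simp
    · simp
  | insert j s hj ih =>
    rw [Finset.sum_insert hj]
    refine ⟨fun p => ?_, fun p h => ?_, fun _ => ?_⟩
    · exact ⟨polyVec_mem_domain X Ω j p, ih.1 p⟩
    · rw [LinearPMap.add_apply, Finset.sum_insert hj, ih.2.1, LinearPMap.smul_apply]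
      congr 2
      exact hX.freeDQ_apply j p _
    · intro v hv
      rw [← hX.freeDQ_domain j]
      exact hv.1

variable {c : Fin n → ℝ}

theorem mem_graph_combDQ (c : Fin n → ℝ) (p : FreeAlgebra ℂ (Fin n)) :
    (polyVec X Ω p, combDQVec X Ω c p) ∈ (combDQ X Ω c).graph := by
  obtain ⟨h1, h2, -⟩ := hX.sum_smul_freeDQ (fun j => (c j : ℂ)) Finset.univ
  rw [LinearPMap.mem_graph_iff]
  refine ⟨⟨polyVec X Ω p, h1 p⟩, rfl, ?_⟩
  rw [combDQVec_apply]
  exact h2 p (h1 p)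

theorem combDQ_domain [NeZero n] (c : Fin n → ℝ) :
    (combDQ X Ω c).domain = LinearMap.range (polyVec X Ω) := by
  obtain ⟨h1, -, h3⟩ := hX.sum_smul_freeDQ (fun j => (c j : ℂ)) Finset.univ
  refine le_antisymm (h3 ⟨0, Finset.mem_univ _⟩) ?_
  rintro _ ⟨p, rfl⟩
  exact h1 p

theorem exists_of_mem_graph_combDQ [NeZero n] {w : H × HTensor H}
    (hw : w ∈ (combDQ X Ω c).graph) : ∃ p, w = (polyVec X Ω p, combDQVec X Ω c p) := by
  have h : w.1 ∈ (combDQ X Ω c).domain := LinearPMap.mem_domain_of_mem_graph hw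
  rw [hX.combDQ_domain] at h
  obtain ⟨p, hp⟩ := h
  refine ⟨p, Prod.ext hp.symm ?_⟩
  have h1 := hX.mem_graph_combDQ c p
  rw [hp] at h1
  exact LinearPMap.mem_graph_snd_inj (combDQ X Ω c) hw h1 rfl

theorem combDQVec_mul (p q : FreeAlgebra ℂ (Fin n)) :
    combDQVec X Ω c (p * q) = leftLeg (FreeAlgebra.lift ℂ X p) (combDQVec X Ω c q) +
      rightLeg (rmul X Ω (FreeAlgebra.lift ℂ X q)) (combDQVec X Ω c p) := by
  simp only [combDQVec_apply, hX.dqVec_mul, smul_add, Finset.sum_add_distrib, map_sum, map_smul]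

theorem isBimoduleDerivation_combDQ [NeZero n] (c : Fin n → ℝ) :
    IsBimoduleDerivation X Ω (combDQ X Ω c) := by
  refine ⟨hX.combDQ_domain c, fun p q u v hu hv => ?_⟩
  refine ⟨_, hX.isRightMul_rmul (lift_mem_wStar X q), ?_⟩
  rw [LinearPMap.mem_graph_snd_inj _ hu (hX.mem_graph_combDQ c p) rfl,
    LinearPMap.mem_graph_snd_inj _ hv (hX.mem_graph_combDQ c q) rfl, ← hX.combDQVec_mul]
  exact hX.mem_graph_combDQ c _

theorem mem_adjoint_graph_combDQ [NeZero n]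
    (hξ : ∀ j, (htmul Ω Ω, ξ j) ∈ (freeDQ X Ω j)†.graph) (c : Fin n → ℝ) :
    (htmul Ω Ω, ∑ j, (c j : ℂ) • ξ j) ∈ (combDQ X Ω c)†.graph := by
  have hd : Dense ((combDQ X Ω c).domain : Set H) := by
    rw [hX.combDQ_domain]
    exact hX.denseRange_polyVec
  have h : ∀ x : (combDQ X Ω c).domain,
      ⟪∑ j, (c j : ℂ) • ξ j, (x : H)⟫_ℂ = ⟪htmul Ω Ω, combDQ X Ω c x⟫_ℂ := by
    intro x
    obtain ⟨p, hp⟩ := hX.exists_of_mem_graph_combDQ ((combDQ X Ω c).mem_graph x)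
    obtain ⟨hp1, hp2⟩ := Prod.ext_iff.1 hp
    simp only at hp1 hp2
    rw [hp1, hp2, combDQVec_apply, sum_inner, inner_sum]
    refine Finset.sum_congr rfl fun j _ => ?_
    rw [inner_smul_left, inner_smul_right, hX.inner_conjugate (hξ j), Complex.conj_ofReal]
  rw [LinearPMap.mem_graph_iff]
  exact ⟨⟨_, LinearPMap.mem_adjoint_domain_of_exists _ ⟨_, h⟩⟩, rfl,
    LinearPMap.adjoint_apply_eq hd _ h⟩

/-- A sum of closable operators need not be closable. Here contractions against polynomial vectors
are bounded in the argument, so a limit of values along arguments tending to 0 is orthogonal to a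
total set of simple tensors. -/
theorem isClosable_combDQ [NeZero n] (hL : IsLipschitzConjugate X Ω ξ Jac) (c : Fin n → ℝ) :
    (combDQ X Ω c).IsClosable := by
  refine ⟨_, (Submodule.toLinearPMap_graph_eq (combDQ X Ω c).graph.topologicalClosure ?_).symm⟩
  intro w hw hw1
  have key : ∀ a : FreeAlgebra ℂ (Fin n), contrL (polyVec X Ω a) w.2 = ∑ j, (c j : ℂ) •
      (tomitaJ X Ω (annihilation X Ω ξ j
        (tomitaJ X Ω (FreeAlgebra.lift ℂ X (starPoly a) w.1))) -
      FreeAlgebra.lift ℂ X (starPoly (rightTraceDQ X Ω j a)) w.1) := by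
    intro a
    have hcl : IsClosed {w : H × HTensor H | contrL (polyVec X Ω a) w.2 = ∑ j, (c j : ℂ) •
      (tomitaJ X Ω (annihilation X Ω ξ j
        (tomitaJ X Ω (FreeAlgebra.lift ℂ X (starPoly a) w.1))) -
      FreeAlgebra.lift ℂ X (starPoly (rightTraceDQ X Ω j a)) w.1)} :=
      isClosed_eq (by fun_prop) (by fun_prop)
    refine hcl.closure_subset_iff.2 ?_ (show w ∈ closure _ from hw)
    intro u hu
    obtain ⟨p, rfl⟩ := hX.exists_of_mem_graph_combDQ hu
    simp only [Set.mem_ofPred_eq, combDQVec_apply, map_sum, map_smul]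
    refine Finset.sum_congr rfl fun j _ => ?_
    have hg : (polyVec X Ω p, dqVec X Ω j p) ∈ (freeDQ X Ω j).closure.graph :=
      LinearPMap.le_graph_of_le (LinearPMap.le_closure _)
        ((hX.mem_graph_freeDQ_iff j _).2 ⟨p, rfl⟩)
    rw [contrL_polyVec_of_mem_closure_graph hX hL hg a]
  refine eq_zero_of_inner_htmul (D := Set.range (polyVec X Ω)) (E := Set.univ)
    hX.denseRange_polyVec dense_univ ?_
  rintro _ ⟨a, rfl⟩ y _
  rw [← inner_contrL, key, hw1]
  simp

end IsTracialTuple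

namespace IsTracialTuple

variable (hX : IsTracialTuple X Ω)
include hX

theorem isSelfAdjoint_centeredGen (j : Fin n) : IsSelfAdjoint (centeredGen X Ω j) := by
  refine (hX.selfAdjoint j).sub ?_
  have h : starRingEnd ℂ (trace Ω (X j)) = trace Ω (X j) := by
    rw [trace, inner_conj_symm]
    exact (hX.selfAdjoint j).isSymmetric Ω Ω
  rw [IsSelfAdjoint, star_smul, star_one]
  congr 1

/-- Since δY = 1 ⊗ 1, Leibniz deletes one factor of Y^m at a time; k counts the factors to the left
of the gap. -/
theorem combDQVec_linearPoly_pow {c : Fin n → ℝ} (hc : ∑ j, c j ^ 2 = 1) (m : ℕ) :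
    combDQVec X Ω c (linearPoly X Ω c ^ m) = ∑ k ∈ Finset.range m,
      htmul (polyVec X Ω (linearPoly X Ω c ^ k))
        (polyVec X Ω (linearPoly X Ω c ^ (m - 1 - k))) := by
  induction m with
  | zero => simp [combDQVec_apply, dqVec_one]
  | succ m ih =>
    rw [pow_succ', hX.combDQVec_mul, combDQVec_linearPoly hc, ih, rightLeg_htmul,
      hX.rmul_Ω (lift_mem_wStar X _), map_sum, Finset.sum_range_succ']
    congr 1
    · refine Finset.sum_congr rfl fun k _ => ?_
      rw [leftLeg_htmul, ← polyVec_mul, ← pow_succ', show m + 1 - 1 - (k + 1) = m - 1 - k by omega]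
    · simp [polyVec_apply]

/-- The moment recursion for a normalized combination of the generators which is also the
combination of the conjugate variables with the same coefficients. -/
theorem trace_pow_succ {c : Fin n → ℝ} (hc : ∑ j, c j ^ 2 = 1)
    (hξ : ∀ j, (htmul Ω Ω, ξ j) ∈ (freeDQ X Ω j)†.graph) {Y : H →L[ℂ] H}
    (hY : Y = ∑ j, (c j : ℂ) • centeredGen X Ω j) (hYξ : Y Ω = ∑ j, (c j : ℂ) • ξ j) (m : ℕ) :
    trace Ω (Y ^ (m + 1)) =
      ∑ k ∈ Finset.range m, trace Ω (Y ^ k) * trace Ω (Y ^ (m - 1 - k)) := by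
  have hsa : IsSelfAdjoint Y := by
    rw [hY]
    refine isSelfAdjoint_sum _ fun j _ => IsSelfAdjoint.smul ?_ (hX.isSelfAdjoint_centeredGen j)
    exact Complex.conj_ofReal _
  have hpow : ∀ k, ⟪(Y ^ k) Ω, Ω⟫_ℂ = trace Ω (Y ^ k) := fun k =>
    (hsa.pow k).isSymmetric Ω Ω
  have hlift : ∀ k, polyVec X Ω (linearPoly X Ω c ^ k) = (Y ^ k) Ω := by
    intro k
    rw [polyVec_apply, map_pow, lift_linearPoly, hY]
  have h1 : trace Ω (Y ^ (m + 1)) = ⟪(Y ^ m) Ω, Y Ω⟫_ℂ := by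
    rw [trace, pow_succ, mul_apply_eq_comp]
    exact ((hsa.pow m).isSymmetric Ω (Y Ω)).symm
  have h2 : ⟪(Y ^ m) Ω, Y Ω⟫_ℂ = ⟪combDQVec X Ω c (linearPoly X Ω c ^ m), htmul Ω Ω⟫_ℂ := by
    rw [hYξ, combDQVec_apply, inner_sum, sum_inner]
    refine Finset.sum_congr rfl fun j _ => ?_
    rw [inner_smul_left, inner_smul_right, Complex.conj_ofReal, ← inner_conj_symm (dqVec _ _ _ _),
      ← hX.inner_conjugate (hξ j), hlift, inner_conj_symm]
  rw [h1, h2, hX.combDQVec_linearPoly_pow hc, sum_inner]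
  refine Finset.sum_congr rfl fun k _ => ?_
  rw [inner_htmul, hlift, hlift, hpow, hpow]

end IsTracialTuple

end Combination

end FreeObata
end
-- Assembly of the main theorem
open FreeObata in
theorem mainTheorem5 {n : ℕ} {H : Type*} [NormedAddCommGroup H] [InnerProductSpace ℂ H]
    [CompleteSpace H] (X : Fin n → H →L[ℂ] H) (Ω : H) (hX : IsTracialTuple X Ω)
    (ξ : Fin n → H) (Jac : Matrix (Fin n) (Fin n) (HTensor H →L[ℂ] HTensor H))
    (hLip : IsLipschitzConjugate X Ω ξ Jac) (hCD : CurvatureDimension 1 Jac)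
    (f : H) (hdom : ∀ j, f ∈ (freeDQ X Ω j).closure.domain)
    (hcentered : ⟪Ω, f⟫_ℂ = 0)
    (hsat : ‖f‖ ^ 2 = ∑ j, ‖(freeDQ X Ω j).closure ⟨f, hdom j⟩‖ ^ 2)
    (hsa : IsL2SelfAdjoint X Ω f) :
    ∃ c : Fin n → ℝ,
      -- (i)
      (f = ∑ j, (c j : ℂ) • centeredGen X Ω j Ω ∧ ∑ j, c j ^ 2 = ‖f‖ ^ 2) ∧
      -- (ii)
      ((∀ p : FreeAlgebra ℂ (Fin n),
          ⟪polyVec X Ω p, f⟫_ℂ =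
              ∑ j, ⟪freeDQ X Ω j ⟨polyVec X Ω p, polyVec_mem_domain X Ω j p⟩,
                (freeDQ X Ω j).closure ⟨f, hdom j⟩⟫_ℂ ∧
          ⟪polyVec X Ω p, f⟫_ℂ =
              ∑ j, (c j : ℂ) * ⟪freeDQ X Ω j ⟨polyVec X Ω p, polyVec_mem_domain X Ω j p⟩,
                htmul Ω Ω⟫_ℂ ∧
          ⟪polyVec X Ω p, f⟫_ℂ = ∑ j, (c j : ℂ) * ⟪polyVec X Ω p, ξ j⟫_ℂ) ∧
        f = ∑ j, (c j : ℂ) • ξ j) ∧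
      (f ≠ 0 →
        -- (iii)
        (IsBimoduleDerivation X Ω (combDQ X Ω fun j => c j / ‖f‖) ∧
          (combDQ X Ω fun j => c j / ‖f‖).IsClosable ∧
          (htmul Ω Ω, (‖f‖⁻¹ : ℂ) • f) ∈ (combDQ X Ω fun j => c j / ‖f‖)†.graph ∧
          (‖f‖⁻¹ : ℂ) • f = ∑ j, ((c j / ‖f‖ : ℝ) : ℂ) • ξ j ∧
          ((‖f‖⁻¹ : ℂ) • f, htmul Ω Ω) ∈ (combDQ X Ω fun j => c j / ‖f‖).graph) ∧
        -- (iv)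
        ∃ Y ∈ wStar (Set.range X), Y Ω = (‖f‖⁻¹ : ℂ) • f ∧
          trace Ω Y = 0 ∧ trace Ω (Y ^ 2) = 1 ∧
          (∀ m : ℕ, 1 ≤ m → trace Ω (Y ^ (m + 1)) =
            ∑ k ∈ Finset.range m, trace Ω (Y ^ k) * trace Ω (Y ^ (m - 1 - k))) ∧
          IsStandardSemicircular Ω Y) := by
  obtain ⟨c, hgrad, hfX, hfξ, hcsq⟩ := exists_coefficients_of_saturated hX hLip hCD
    (fun j => (freeDQ X Ω j).closure.mem_graph ⟨f, hdom j⟩) hcentered hsat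
    (hX.tomitaJ_eq_self hsa)
  have hξ : ∀ p : FreeAlgebra ℂ (Fin n),
      ⟪polyVec X Ω p, f⟫_ℂ = ∑ j, (c j : ℂ) * ⟪polyVec X Ω p, ξ j⟫_ℂ := by
    intro p
    conv_lhs => rw [hfξ]
    rw [inner_sum]
    exact Finset.sum_congr rfl fun j _ => inner_smul_right _ _ _
  have hd : ∀ p : FreeAlgebra ℂ (Fin n), ⟪polyVec X Ω p, f⟫_ℂ =
      ∑ j, (c j : ℂ) * ⟪freeDQ X Ω j ⟨polyVec X Ω p, polyVec_mem_domain X Ω j p⟩,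
        htmul Ω Ω⟫_ℂ := by
    intro p
    rw [hξ]
    refine Finset.sum_congr rfl fun j _ => ?_
    rw [hX.freeDQ_apply, ← inner_conj_symm, hX.inner_conjugate (hLip.conjugate j),
      inner_conj_symm]
  refine ⟨c, ⟨hfX, hcsq⟩, ⟨fun p => ⟨?_, hd p, hξ p⟩, hfξ⟩, fun hf0 => ?_⟩
  · rw [hd]
    refine Finset.sum_congr rfl fun j _ => ?_
    rw [hgrad, inner_smul_right]
  -- For n = 0 the expansion of f in the generators is an empty sum, contradicting f ≠ 0.
  have hn : NeZero n := by
    refine ⟨?_⟩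
    rintro rfl
    exact hf0 (by rw [hfX]; simp)
  have hσ : ‖f‖ ≠ 0 := norm_ne_zero_iff.2 hf0
  have hc1 : ∑ j, (c j / ‖f‖) ^ 2 = 1 := by
    simp_rw [div_pow, ← Finset.sum_div, hcsq]
    exact div_self (pow_ne_zero 2 hσ)
  have hscale : ∀ v : Fin n → H, f = ∑ j, (c j : ℂ) • v j →
      (‖f‖⁻¹ : ℂ) • f = ∑ j, ((c j / ‖f‖ : ℝ) : ℂ) • v j := by
    intro v hv
    conv_lhs => rw [hv]
    rw [Finset.smul_sum, ← hv]
    refine Finset.sum_congr rfl fun j _ => ?_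
    rw [smul_smul, Complex.ofReal_div, div_eq_inv_mul]
  have hYξ := hscale ξ hfξ
  have hYX := hscale _ hfX
  have hYΩ : (∑ j, ((c j / ‖f‖ : ℝ) : ℂ) • centeredGen X Ω j) Ω = (‖f‖⁻¹ : ℂ) • f := by
    rw [hYX]
    simp
  have hrec := hX.trace_pow_succ hc1 hLip.conjugate rfl (hYΩ.trans hYξ)
  have hpoly : polyVec X Ω (linearPoly X Ω fun j => c j / ‖f‖) = (‖f‖⁻¹ : ℂ) • f := by
    rw [polyVec_apply, lift_linearPoly, hYΩ]
  have h0 : trace Ω ((∑ j, ((c j / ‖f‖ : ℝ) : ℂ) • centeredGen X Ω j) ^ 0) = 1 := by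
    rw [pow_zero, trace, one_apply_eq_self, hX.inner_self]
  have h1 : trace Ω (∑ j, ((c j / ‖f‖ : ℝ) : ℂ) • centeredGen X Ω j) = 0 := by
    rw [trace, hYΩ, inner_smul_right, hcentered, mul_zero]
  refine ⟨⟨hX.isBimoduleDerivation_combDQ _, hX.isClosable_combDQ hLip _, ?_, hYξ, ?_⟩,
    ∑ j, ((c j / ‖f‖ : ℝ) : ℂ) • centeredGen X Ω j, ?_, hYΩ, h1, ?_, fun m _ => hrec m, ?_, ?_⟩
  · rw [hYξ]
    exact hX.mem_adjoint_graph_combDQ hLip.conjugate _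
  · rw [← hpoly, ← combDQVec_linearPoly hc1]
    exact hX.mem_graph_combDQ _ _
  · rw [← lift_linearPoly]
    exact lift_mem_wStar X _
  · have h := hrec 1
    rw [Finset.sum_range_one] at h
    rw [h, h0, one_mul]
  · refine isSelfAdjoint_sum _ fun j _ => IsSelfAdjoint.smul ?_ (hX.isSelfAdjoint_centeredGen j)
    exact Complex.conj_ofReal _
  · exact moments_eq_integral_semicircleLaw h0 (by rw [pow_one, h1]) fun m _ => hrec m
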